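/- Let $K$ be a field with $\operatorname{char}K=0$ or $\operatorname{char}K>3$. Let $R=K[x_{\{i,j\}} : \{i,j\}\subset\{1,2,3,4\},\ i\neq j]$ be the polynomial algebra in six variables on which $S_4$ acts by $\sigma\cdot x_{\{i,j\}}=x_{\{\sigma(i),\sigma(j)\}}$, and let $R^{S_4}$ be the algebra of invariants. Put $$x_1=x_{\{1,2\}}+x_{\{3,4\}},\quad x_2=x_{\{1,3\}}+x_{\{2,4\}},\quad x_3=x_{\{1,4\}}+x_{\{2,3\}},$$ $$z_1=x_{\{1,2\}}-x_{\{3,4\}},\quad z_2=x_{\{1,3\}}-x_{\{2,4\}},\quad z_3=x_{\{1,4\}}-x_{\{2,3\}},$$ and for $w\in K[x,z]$ put $[w]=w(x_1,z_1)+w(x_2,z_2)+w(x_3,z_3)\in R$. Let $$\mathcal F=K[T_w,S \mid w\in\{x,x^2,x^3,y,y^2,y^3,xy,x^2y,xy^2\}]$$ be the polynomial algebra in ten variables, let $\phi:\mathcal F\to R$ be the $K$-algebra homomorphism with $\phi(S)=z_1z_2z_3$ and $\phi(T_w)=[w(x,z^2)]$, where $w(x,z^2)$ denotes $w$ with $y$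 replaced by $z^2$, and let $\mathcal F_1\subset\mathcal F$ be the subalgebra generated by all the variables except $T_{y^3}$. Consider the following elements of $\mathcal F$: \begin{align*} J_{3,2}={}&6T_{x^2y}T_{xy}-3T_{xy^2}T_{x^2}-2T_{x^2y}T_xT_y+T_{xy^2}T_x^2-4T_{xy}^2T_x+2T_{xy}T_x^2T_y\\ &-3T_{x^3}T_{y^2}+4T_{x^2}T_xT_{y^2}-T_x^3T_{y^2}+T_{x^3}T_y^2-T_{x^2}T_xT_y^2,\\ J_{2,3}={}&6T_{xy^2}T_{xy}-3T_{x^2y}T_{y^2}-2T_{xy^2}T_xT_y+T_{x^2y}T_y^2-4T_{xy}^2T_y+2T_{xy}T_y^2T_x\\ &-3T_{y^3}T_{x^2}+4T_{y^2}T_yT_{x^2}-T_y^3T_{x^2}+T_{y^3}T_x^2-T_{y^2}T_yT_x^2,\\ J_{4,2}={}&6T_{x^2y}^2+T_{xy}^2T_{x^2}-3T_{xy}^2T_x^2-6T_{x^3}T_{xy^2}+2T_{x^2}T_{xy^2}T_x+4T_{x^3}T_{xy}T_y\\ &-2T_{x^2}T_{xy}T_xT_y+2T_{xy}T_x^3T_y-4T_{x^2y}T_{x^2}T_y-T_{x^2}^2T_{y^2}+T_{x^2}^2T_y^2\\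 &+4T_{x^2}T_x^2T_{y^2}-T_{x^2}T_x^2T_y^2-T_x^4T_{y^2}-2T_{x^3}T_xT_{y^2},\\ J_{3,3}={}&3T_{x^2y}T_{xy^2}-T_{xy}T_{x^2}T_{y^2}+T_{xy}^3+T_{xy}T_x^2T_{y^2}-5T_{xy}^2T_xT_y-3T_{x^3}T_{y^3}\\ &+2T_{xy}T_{xy^2}T_x+T_{x^2}T_xT_{y^3}-3T_{x^2}T_{xy^2}T_y+2T_{x^2y}T_{xy}T_y+3T_{x^2}T_xT_{y^2}T_y\\ &+T_{x^3}T_{y^2}T_y+T_{x^2}T_{xy}T_y^2-T_x^3T_{y^2}T_y+2T_x^2T_{xy}T_y^2-T_{x^2}T_xT_y^3-3T_xT_{x^2y}T_{y^2},\\ J_{2,4}={}&6T_{xy^2}^2+T_{xy}^2T_{y^2}-3T_{xy}^2T_y^2-6T_{y^3}T_{x^2y}+2T_{y^2}T_{x^2y}T_y+4T_{y^3}T_{xy}T_x\\ &-2T_{y^2}T_{xy}T_xT_y+2T_{xy}T_y^3T_x-4T_{xy^2}T_{y^2}T_x-T_{y^2}^2T_{x^2}+T_{y^2}^2T_x^2\\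 &+4T_{y^2}T_y^2T_{x^2}-T_{y^2}T_y^2T_x^2-T_y^4T_{x^2}-2T_{y^3}T_yT_{x^2}, \end{align*} and let $\tilde J_{a,b}\in\mathcal F_1$ be obtained from $J_{a,b}$ by the substitution $$T_{y^3}\mapsto 3S^2+\tfrac32T_{y^2}T_y-\tfrac12T_y^3.$$ Here a family of elements of an algebra (respectively of an ideal) is said to generate it minimally if it generates it, no proper subfamily does, and no generating set has fewer elements. Then: (i) The $K$-algebra $R^{S_4}$ is minimally generated by the nine elements $$[x],\ [x^2],\ [x^3],\ [z^2],\ [z^4],\ [xz^2],\ [x^2z^2],\ [xz^4],\ z_1z_2z_3.$$ (ii) The homomorphism $\phi|_{\mathcal F_1}$ maps $\mathcal F_1$ onto $R^{S_4}$, and its kernel is minimally generated, as an ideal of $\mathcal F_1$, by the five elements $\tilde J_{3,2},\ \tilde J_{2,3},\ \tilde J_{4,2},\ \tilde J_{3,3},\ \tilde J_{2,4}$. -/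

import Mathlib

noncomputable section

namespace PairInvariants

open MvPolynomial

/-! ### Minimal generating families -/

/-- The family `g` minimally generates the subalgebra `B`: it generates `B`, no proper subfamily
does, and no generating set of `B` has fewer elements than the family has members. -/
structure MinimallyGeneratesAlgebra (K : Type*) {A ι : Type*} [CommRing K] [CommRing A]
    [Algebra K A] (g : ι → A) (B : Subalgebra K A) : Prop where
  generates : Algebra.adjoin K (Set.range g) = B
  irredundant : ∀ s : Set ι, s ≠ Set.univ → Algebra.adjoin K (g '' s) ≠ B
  card_le : ∀ t : Set A, Algebra.adjoin K t = B → ENat.card ι ≤ t.encard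

/-- The family `g` minimally generates the ideal `I`: it generates `I`, no proper subfamily
does, and no generating set of `I` has fewer elements than the family has members. -/
structure MinimallyGeneratesIdeal {A ι : Type*} [CommRing A] (g : ι → A) (I : Ideal A) :
    Prop where
  generates : Ideal.span (Set.range g) = I
  irredundant : ∀ s : Set ι, s ≠ Set.univ → Ideal.span (g '' s) ≠ I
  card_le : ∀ t : Set A, Ideal.span t = I → ENat.card ι ≤ t.encard

/-! ### The symmetric group acting on pairs -/

/-- The two-element subsets of the four-element set `Fin 4 = {0, 1, 2, 3}`
(the element `i` of `Fin 4` stands for `i + 1` in `{1, 2, 3, 4}`). -/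
abbrev Pair : Type := {s : Finset (Fin 4) // s.card = 2}

/-- The pair `{i, j}`. -/
def pair (i j : Fin 4) (h : i ≠ j) : Pair := ⟨{i, j}, Finset.card_pair h⟩

/-- `σ` sends `{i, j}` to `{σ i, σ j}`. -/
def permPair (σ : Equiv.Perm (Fin 4)) (p : Pair) : Pair :=
  ⟨p.1.map σ.toEmbedding, by rw [Finset.card_map, p.2]⟩

variable (K : Type*) [Field K]

/-- The polynomial algebra in the six variables `x_{i,j}`. -/
abbrev R : Type _ := MvPolynomial Pair K

/-- The algebra of `S₄`-invariants, where `σ` acts on `R` by `x_{i,j} ↦ x_{σ i, σ j}`. -/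
def invariants : Subalgebra K (R K) where
  carrier := {f | ∀ σ : Equiv.Perm (Fin 4), rename (permPair σ) f = f}
  mul_mem' hf hg σ := by rw [map_mul, hf σ, hg σ]
  add_mem' hf hg σ := by rw [map_add, hf σ, hg σ]
  algebraMap_mem' c σ := by rw [AlgHom.commutes]

/-- The elements `x₁ = x_{12} + x_{34}`, `x₂ = x_{13} + x_{24}`, `x₃ = x_{14} + x_{23}`. -/
def xs : Fin 3 → R K :=
  ![X (pair 0 1 (by decide)) + X (pair 2 3 (by decide)),
    X (pair 0 2 (by decide)) + X (pair 1 3 (by decide)),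
    X (pair 0 3 (by decide)) + X (pair 1 2 (by decide))]

/-- The elements `z₁ = x_{12} - x_{34}`, `z₂ = x_{13} - x_{24}`, `z₃ = x_{14} - x_{23}`. -/
def zs : Fin 3 → R K :=
  ![X (pair 0 1 (by decide)) - X (pair 2 3 (by decide)),
    X (pair 0 2 (by decide)) - X (pair 1 3 (by decide)),
    X (pair 0 3 (by decide)) - X (pair 1 2 (by decide))]

variable {K} in
/-- For `w ∈ K[x, z]` (with `x = X 0` and `z = X 1`), the element
`[w] = w(x₁, z₁) + w(x₂, z₂) + w(x₃, z₃)` of `R`; this is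
`w ⊗ 1 ⊗ 1 + 1 ⊗ w ⊗ 1 + 1 ⊗ 1 ⊗ w` under the identification of the third tensor power of
`K[x, z]` with `R`. -/
def bracket (w : MvPolynomial (Fin 2) K) : R K :=
  ∑ i : Fin 3, aeval ![xs K i, zs K i] w

/-- The nine elements
`[x], [x²], [x³], [z²], [z⁴], [xz²], [x²z²], [xz⁴], z₁z₂z₃`. -/
def nineGenerators : Fin 9 → R K :=
  ![bracket (X 0), bracket (X 0 ^ 2), bracket (X 0 ^ 3), bracket (X 1 ^ 2), bracket (X 1 ^ 4),
    bracket (X 0 * X 1 ^ 2), bracket (X 0 ^ 2 * X 1 ^ 2), bracket (X 0 * X 1 ^ 4),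
    zs K 0 * zs K 1 * zs K 2]

/-! ### The presentation -/

/-- Labels of the ten variables of `F`: nine monomials `w` in `x, y`, labelling the variables
`T_w`, and the label of the variable `S`. -/
inductive Label : Type
  | x | x2 | x3 | y | y2 | y3 | xy | x2y | xy2 | S
  deriving DecidableEq

/-- The ten-variable polynomial algebra `F = K[T_w, S]`. -/
abbrev F : Type _ := MvPolynomial Label K

/-- The variables of `F`: `T K w` is `T_w`, and `T K .S` is `S`. -/
abbrev T (w : Label) : F K := X w

/-- The homomorphism `ψ : K[x, y] → K[x, z]`, `x ↦ x`, `y ↦ z²`. -/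
def psi : MvPolynomial (Fin 2) K →ₐ[K] MvPolynomial (Fin 2) K := aeval ![X 0, X 1 ^ 2]

/-- The values of `φ` on the variables: `T_w ↦ [ψ(w)]` and `S ↦ z₁z₂z₃`. -/
def phiVar : Label → R K
  | .x => bracket (psi K (X 0))
  | .x2 => bracket (psi K (X 0 ^ 2))
  | .x3 => bracket (psi K (X 0 ^ 3))
  | .y => bracket (psi K (X 1))
  | .y2 => bracket (psi K (X 1 ^ 2))
  | .y3 => bracket (psi K (X 1 ^ 3))
  | .xy => bracket (psi K (X 0 * X 1))
  | .x2y => bracket (psi K (X 0 ^ 2 * X 1))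
  | .xy2 => bracket (psi K (X 0 * X 1 ^ 2))
  | .S => zs K 0 * zs K 1 * zs K 2

/-- The homomorphism `φ`, with values in the ambient ring `R`. -/
def phi : F K →ₐ[K] R K := aeval (phiVar K)

/-- The nine-variable polynomial algebra `F₁`, in all the variables of `F` except `T_{y³}`. -/
abbrev F₁ : Type _ := MvPolynomial {v : Label // v ≠ .y3} K

/-- The inclusion of `F₁` in `F`. -/
def incl : F₁ K →ₐ[K] F K := rename Subtype.val

/-- The restriction of `φ` to `F₁`. -/
def phi₁ : F₁ K →ₐ[K] R K := (phi K).comp (incl K)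

def J32 : F K :=
    6 * T K .x2y * T K .xy - 3 * T K .xy2 * T K .x2 - 2 * T K .x2y * T K .x * T K .y
    + T K .xy2 * T K .x ^ 2 - 4 * T K .xy ^ 2 * T K .x
    + 2 * T K .xy * T K .x ^ 2 * T K .y - 3 * T K .x3 * T K .y2
    + 4 * T K .x2 * T K .x * T K .y2 - T K .x ^ 3 * T K .y2 + T K .x3 * T K .y ^ 2
    - T K .x2 * T K .x * T K .y ^ 2

def J23 : F K :=
    6 * T K .xy2 * T K .xy - 3 * T K .x2y * T K .y2 - 2 * T K .xy2 * T K .x * T K .y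
    + T K .x2y * T K .y ^ 2 - 4 * T K .xy ^ 2 * T K .y
    + 2 * T K .xy * T K .y ^ 2 * T K .x - 3 * T K .y3 * T K .x2
    + 4 * T K .y2 * T K .y * T K .x2 - T K .y ^ 3 * T K .x2 + T K .y3 * T K .x ^ 2
    - T K .y2 * T K .y * T K .x ^ 2

def J42 : F K :=
    6 * T K .x2y ^ 2 + T K .xy ^ 2 * T K .x2 - 3 * T K .xy ^ 2 * T K .x ^ 2
    - 6 * T K .x3 * T K .xy2 + 2 * T K .x2 * T K .xy2 * T K .x
    + 4 * T K .x3 * T K .xy * T K .y - 2 * T K .x2 * T K .xy * T K .x * T K .y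
    + 2 * T K .xy * T K .x ^ 3 * T K .y - 4 * T K .x2y * T K .x2 * T K .y
    - T K .x2 ^ 2 * T K .y2 + T K .x2 ^ 2 * T K .y ^ 2
    + 4 * T K .x2 * T K .x ^ 2 * T K .y2 - T K .x2 * T K .x ^ 2 * T K .y ^ 2
    - T K .x ^ 4 * T K .y2 - 2 * T K .x3 * T K .x * T K .y2

def J33 : F K :=
    3 * T K .x2y * T K .xy2 - T K .xy * T K .x2 * T K .y2 + T K .xy ^ 3
    + T K .xy * T K .x ^ 2 * T K .y2 - 5 * T K .xy ^ 2 * T K .x * T K .y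
    - 3 * T K .x3 * T K .y3 + 2 * T K .xy * T K .xy2 * T K .x
    + T K .x2 * T K .x * T K .y3 - 3 * T K .x2 * T K .xy2 * T K .y
    + 2 * T K .x2y * T K .xy * T K .y + 3 * T K .x2 * T K .x * T K .y2 * T K .y
    + T K .x3 * T K .y2 * T K .y + T K .x2 * T K .xy * T K .y ^ 2
    - T K .x ^ 3 * T K .y2 * T K .y + 2 * T K .x ^ 2 * T K .xy * T K .y ^ 2
    - T K .x2 * T K .x * T K .y ^ 3 - 3 * T K .x * T K .x2y * T K .y2

def J24 : F K :=
    6 * T K .xy2 ^ 2 + T K .xy ^ 2 * T K .y2 - 3 * T K .xy ^ 2 * T K .y ^ 2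
    - 6 * T K .y3 * T K .x2y + 2 * T K .y2 * T K .x2y * T K .y
    + 4 * T K .y3 * T K .xy * T K .x - 2 * T K .y2 * T K .xy * T K .x * T K .y
    + 2 * T K .xy * T K .y ^ 3 * T K .x - 4 * T K .xy2 * T K .y2 * T K .x
    - T K .y2 ^ 2 * T K .x2 + T K .y2 ^ 2 * T K .x ^ 2
    + 4 * T K .y2 * T K .y ^ 2 * T K .x2 - T K .y2 * T K .y ^ 2 * T K .x ^ 2
    - T K .y ^ 4 * T K .x2 - 2 * T K .y3 * T K .y * T K .x2

/-- The substitution `T_{y³} ↦ 3 S² + (3/2) T_{y²} T_y - (1/2) T_y³`, which fixes all the other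
variables. -/
def subst : F K →ₐ[K] F₁ K :=
  aeval fun v =>
    if h : v = .y3 then
      3 * X ⟨.S, by decide⟩ ^ 2 + C (3 / 2) * X ⟨.y2, by decide⟩ * X ⟨.y, by decide⟩
        - C (1 / 2) * X ⟨.y, by decide⟩ ^ 3
    else X ⟨v, h⟩

/-- The five elements obtained from `J_{3,2}, J_{2,3}, J_{4,2}, J_{3,3}, J_{2,4}` by the
substitution. -/
def Jtilde : Fin 5 → F₁ K :=
  ![subst K (J32 K), subst K (J23 K), subst K (J42 K), subst K (J33 K), subst K (J24 K)]

end PairInvariants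

end

noncomputable section

namespace PairInvariants

open MvPolynomial

variable (K : Type*) [Field K]

/-! Write u, v, w for T_{xy}, T_{x²y}, T_{xy²}, let P be the polynomial ring on the other six
variables of F₁ (the parameters), and put y_i = z_i².

Kernel. The five relations can be solved for uv, uw, v², w² and vw, so modulo them F₁ is spanned
over P by 1, u, v, w, u², u³ (`exists_reduction`). The images of these six elements are linearly
independent over P (`eq_zero_of_phi₁_eq_zero`): the parameters are symmetric in the x_i and in the
z_i separately, so permuting the z_i alone turns one dependence into six linear equations with
nonzero determinant. Moreover P embeds, since the ring in the six x_i, z_i is integral over its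
image (`paramValue_algebraicIndependent`). Hence an element of the kernel reduces to zero modulo the
relations (`ker_phi₁`).

Image. S₄ permutes the indices of the x_i and z_i simultaneously, together with an even number of
sign changes of the z_i. When a monomial is summed over the group, the sign changes kill it unless
its three z-exponents have the same parity. A surviving monomial is a monomial in the x_i and y_i,
possibly times S, and its symmetrization is a polynomial in the power sums [x^a y^b]. As there are
only three points, power sums of degree at least 4 reduce to shorter ones (`powerBracket_mem_step`),
and [y³] is redundant by Newton's formula with y₁y₂y₃ = S².

Minimality. This is Nakayama's lemma at the origin. The kernel has no constant or linear terms, so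
the linear parts of lifts of any generating set span K⁹; five second derivatives separate the J̃
modulo the maximal ideal times the kernel. -/

/-! ### Values of φ on the variables, and the five relations. -/

theorem phi_T (v : Label) : phi K (T K v) = phiVar K v := aeval_X _ _

theorem bracket_psi (w : MvPolynomial (Fin 2) K) :
    bracket (psi K w) = ∑ i : Fin 3, aeval ![xs K i, zs K i ^ 2] w := by
  refine Finset.sum_congr rfl fun i _ => ?_
  have h : (aeval ![xs K i, zs K i]).comp (psi K) = aeval ![xs K i, zs K i ^ 2] := by
    apply MvPolynomial.algHom_ext
    intro j
    fin_cases j <;> simp only [psi, AlgHom.comp_apply, aeval_X] <;>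
      simp only [Fin.zero_eta, Fin.mk_one, Matrix.cons_val_zero, Matrix.cons_val_one, map_pow,
        aeval_X]
  exact DFunLike.congr_fun h w

/-- The weights `w(x_i, z_i²)` of the labels; the label `S` has the dummy weight `0`. -/
def labelValue {A : Type*} [CommRing A] (x y : A) : Label → A
  | .x => x
  | .x2 => x ^ 2
  | .x3 => x ^ 3
  | .y => y
  | .y2 => y ^ 2
  | .y3 => y ^ 3
  | .xy => x * y
  | .x2y => x ^ 2 * y
  | .xy2 => x * y ^ 2
  | .S => 0

theorem phiVar_eq {v : Label} (h : v ≠ .S) :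
    phiVar K v = ∑ i : Fin 3, labelValue (xs K i) (zs K i ^ 2) v := by
  cases v
  case S => exact absurd rfl h
  all_goals
    refine (bracket_psi K _).trans (Finset.sum_congr rfl fun i _ => ?_)
    simp only [map_mul, map_pow, aeval_X, labelValue, Matrix.cons_val_zero, Matrix.cons_val_one]

theorem phiVar_x : phiVar K .x = xs K 0 + xs K 1 + xs K 2 :=
  (phiVar_eq K (by decide)).trans (Fin.sum_univ_three _)

theorem phiVar_x2 : phiVar K .x2 = xs K 0 ^ 2 + xs K 1 ^ 2 + xs K 2 ^ 2 :=
  (phiVar_eq K (by decide)).trans (Fin.sum_univ_three _)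

theorem phiVar_x3 : phiVar K .x3 = xs K 0 ^ 3 + xs K 1 ^ 3 + xs K 2 ^ 3 :=
  (phiVar_eq K (by decide)).trans (Fin.sum_univ_three _)

theorem phiVar_y : phiVar K .y = zs K 0 ^ 2 + zs K 1 ^ 2 + zs K 2 ^ 2 :=
  (phiVar_eq K (by decide)).trans (Fin.sum_univ_three _)

theorem phiVar_y2 : phiVar K .y2 = (zs K 0 ^ 2) ^ 2 + (zs K 1 ^ 2) ^ 2 + (zs K 2 ^ 2) ^ 2 :=
  (phiVar_eq K (by decide)).trans (Fin.sum_univ_three _)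

theorem phiVar_y3 : phiVar K .y3 = (zs K 0 ^ 2) ^ 3 + (zs K 1 ^ 2) ^ 3 + (zs K 2 ^ 2) ^ 3 :=
  (phiVar_eq K (by decide)).trans (Fin.sum_univ_three _)

theorem phiVar_xy : phiVar K .xy = xs K 0 * zs K 0 ^ 2 + xs K 1 * zs K 1 ^ 2 + xs K 2 * zs K 2 ^ 2 :=
  (phiVar_eq K (by decide)).trans (Fin.sum_univ_three _)

theorem phiVar_x2y : phiVar K .x2y = xs K 0 ^ 2 * zs K 0 ^ 2 + xs K 1 ^ 2 * zs K 1 ^ 2 + xs K 2 ^ 2 * zs K 2 ^ 2 :=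
  (phiVar_eq K (by decide)).trans (Fin.sum_univ_three _)

theorem phiVar_xy2 : phiVar K .xy2 = xs K 0 * (zs K 0 ^ 2) ^ 2 + xs K 1 * (zs K 1 ^ 2) ^ 2 + xs K 2 * (zs K 2 ^ 2) ^ 2 :=
  (phiVar_eq K (by decide)).trans (Fin.sum_univ_three _)

theorem phiVar_S : phiVar K .S = zs K 0 * zs K 1 * zs K 2 := rfl

theorem subst_T {v : Label} (h : v ≠ .y3) : subst K (T K v) = X ⟨v, h⟩ :=
  (aeval_X _ _).trans (dif_neg h)

theorem phi₁_X (v : {v : Label // v ≠ .y3}) : phi₁ K (X v) = phiVar K v := by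
  rw [phi₁, AlgHom.comp_apply, incl, rename_X]
  exact phi_T K v

/-- This is Newton's formula for the third power sum of z₁², z₂², z₃², whose product is the square
of the image of S. Both sides are doubled to clear the halves. -/
theorem phi₁_comp_subst (h2 : (2 : K) ≠ 0) : (phi₁ K).comp (subst K) = phi K := by
  apply MvPolynomial.algHom_ext
  intro v
  by_cases hv : v = .y3
  · subst hv
    have h : (C (3 / 2) : R K) * 2 = 3 := by
      rw [show (2 : R K) = C 2 from (map_ofNat C 2).symm, ← C_mul, div_mul_cancel₀ _ h2, map_ofNat]
    have h' : (C (1 / 2) : R K) * 2 = 1 := by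
      rw [show (2 : R K) = C 2 from (map_ofNat C 2).symm, ← C_mul, div_mul_cancel₀ _ h2, map_one]
    have h2' : (2 : R K) ≠ 0 := by
      rw [show (2 : R K) = C 2 from (map_ofNat C 2).symm]
      exact (map_ne_zero_iff _ (C_injective _ _)).2 h2
    apply mul_right_cancel₀ h2'
    have hC (c : K) : phi₁ K (C c) = C c := (phi₁ K).commutes c
    rw [AlgHom.comp_apply, phi_T, phiVar_y3, subst, aeval_X, dif_pos rfl]
    simp only [map_add, map_sub, map_mul, map_pow, map_ofNat, phi₁_X, hC, phiVar_S, phiVar_y,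
      phiVar_y2]
    linear_combination (zs K 0 ^ 2 + zs K 1 ^ 2 + zs K 2 ^ 2) *
      ((zs K 0 ^ 2) ^ 2 + (zs K 1 ^ 2) ^ 2 + (zs K 2 ^ 2) ^ 2) * h -
      (zs K 0 ^ 2 + zs K 1 ^ 2 + zs K 2 ^ 2) ^ 3 * h'
  · rw [AlgHom.comp_apply, subst_T K hv, phi₁_X, phi_T]

theorem phi_J32 : phi K (J32 K) = 0 := by
  simp only [J32, map_add, map_sub, map_mul, map_pow, map_ofNat, phi_T, phiVar_x, phiVar_x2,
    phiVar_x3, phiVar_y, phiVar_y2, phiVar_xy, phiVar_x2y, phiVar_xy2]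
  generalize xs K 0 = a, xs K 1 = b, xs K 2 = c, zs K 0 ^ 2 = d, zs K 1 ^ 2 = e, zs K 2 ^ 2 = f
  ring

theorem phi_J23 : phi K (J23 K) = 0 := by
  simp only [J23, map_add, map_sub, map_mul, map_pow, map_ofNat, phi_T, phiVar_x, phiVar_x2,
    phiVar_y, phiVar_y2, phiVar_y3, phiVar_xy, phiVar_x2y, phiVar_xy2]
  generalize xs K 0 = a, xs K 1 = b, xs K 2 = c, zs K 0 ^ 2 = d, zs K 1 ^ 2 = e, zs K 2 ^ 2 = f
  ring

theorem phi_J42 : phi K (J42 K) = 0 := by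
  simp only [J42, map_add, map_sub, map_mul, map_pow, map_ofNat, phi_T, phiVar_x, phiVar_x2,
    phiVar_x3, phiVar_y, phiVar_y2, phiVar_xy, phiVar_x2y, phiVar_xy2]
  generalize xs K 0 = a, xs K 1 = b, xs K 2 = c, zs K 0 ^ 2 = d, zs K 1 ^ 2 = e, zs K 2 ^ 2 = f
  ring

theorem phi_J33 : phi K (J33 K) = 0 := by
  simp only [J33, map_add, map_sub, map_mul, map_pow, map_ofNat, phi_T, phiVar_x, phiVar_x2,
    phiVar_x3, phiVar_y, phiVar_y2, phiVar_y3, phiVar_xy, phiVar_x2y, phiVar_xy2]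
  generalize xs K 0 = a, xs K 1 = b, xs K 2 = c, zs K 0 ^ 2 = d, zs K 1 ^ 2 = e, zs K 2 ^ 2 = f
  ring

theorem phi_J24 : phi K (J24 K) = 0 := by
  simp only [J24, map_add, map_sub, map_mul, map_pow, map_ofNat, phi_T, phiVar_x, phiVar_x2,
    phiVar_y, phiVar_y2, phiVar_y3, phiVar_xy, phiVar_x2y, phiVar_xy2]
  generalize xs K 0 = a, xs K 1 = b, xs K 2 = c, zs K 0 ^ 2 = d, zs K 1 ^ 2 = e, zs K 2 ^ 2 = f
  ring

theorem phi₁_Jtilde (h2 : (2 : K) ≠ 0) (i : Fin 5) : phi₁ K (Jtilde K i) = 0 := by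
  have h (f : F K) : phi₁ K (subst K f) = phi K f :=
    DFunLike.congr_fun (phi₁_comp_subst K h2) f
  fin_cases i
  exacts [(h _).trans (phi_J32 K), (h _).trans (phi_J23 K), (h _).trans (phi_J42 K),
    (h _).trans (phi_J33 K), (h _).trans (phi_J24 K)]

/-! ### Spanning: F₁ modulo the five relations as a module over the parameters. -/

section Reduction

variable {Q B : Type*} [CommRing Q] [CommRing B] [Algebra Q B]

theorem mul_mem_of_span_le {s : Set B} {N : Submodule Q B} {g : B} (h : ∀ m ∈ s, g * m ∈ N)
    {f : B} (hf : f ∈ Submodule.span Q s) : g * f ∈ N := by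
  have : Submodule.span Q s ≤ N.comap (LinearMap.mulLeft Q g) := Submodule.span_le.2 h
  exact this hf

/-- The span of `1, u, v, w, u², u³` is stable under multiplication by `u`, `v` and `w` as soon
as the quadratic monomials other than `u²` can be rewritten suitably. -/
theorem span_stable {u v w : B}
    (huv : u * v ∈ Submodule.span Q {1, u, v, w, u ^ 2})
    (huw : u * w ∈ Submodule.span Q {1, u, v, w, u ^ 2})
    (hvv : v ^ 2 ∈ Submodule.span Q {1, u, v, w, u ^ 2})
    (hww : w ^ 2 ∈ Submodule.span Q {1, u, v, w, u ^ 2})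
    (hvw : v * w ∈ Submodule.span Q {1, u, v, w, u ^ 2, u ^ 3})
    {q : Q} (hu3 : u ^ 3 + q • (v * w) ∈ Submodule.span Q {1, u, v, w, u ^ 2})
    {g : B} (hg : g = u ∨ g = v ∨ g = w)
    {f : B} (hf : f ∈ Submodule.span Q {1, u, v, w, u ^ 2, u ^ 3}) :
    g * f ∈ Submodule.span Q {1, u, v, w, u ^ 2, u ^ 3} := by
  set N₅ := Submodule.span Q {1, u, v, w, u ^ 2}
  set N₆ := Submodule.span Q {1, u, v, w, u ^ 2, u ^ 3}
  have hle : N₅ ≤ N₆ := Submodule.span_mono fun m hm => by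
    simp only [Set.mem_insert_iff, Set.mem_singleton_iff] at hm ⊢
    tauto
  have hN₆ : ∀ m ∈ ({1, u, v, w, u ^ 2, u ^ 3} : Set B), m ∈ N₆ := fun m hm =>
    Submodule.subset_span hm
  simp only [Set.mem_insert_iff, Set.mem_singleton_iff, forall_eq_or_imp, forall_eq] at hN₆
  obtain ⟨h1, hu, hv, hw, hu2, hu3'⟩ := hN₆
  have hu5 {f : B} (hf : f ∈ N₅) : u * f ∈ N₆ := by
    refine mul_mem_of_span_le (s := {1, u, v, w, u ^ 2}) ?_ hf
    simp only [Set.mem_insert_iff, Set.mem_singleton_iff, forall_eq_or_imp, forall_eq]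
    refine ⟨by rwa [mul_one], by rwa [← sq], hle huv, hle huw, by rwa [← pow_succ']⟩
  have hv5 {f : B} (hf : f ∈ N₅) : v * f ∈ N₆ := by
    refine mul_mem_of_span_le (s := {1, u, v, w, u ^ 2}) ?_ hf
    simp only [Set.mem_insert_iff, Set.mem_singleton_iff, forall_eq_or_imp, forall_eq]
    refine ⟨by rwa [mul_one], by rw [mul_comm]; exact hle huv, by rw [← sq]; exact hle hvv, hvw,
      ?_⟩
    -- It matters that uv lies in the smaller span `N₅`: stability of `N₆` under u is not yet
    -- available.
    rw [show v * u ^ 2 = u * (u * v) by ring]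
    exact hu5 huv
  have hw5 {f : B} (hf : f ∈ N₅) : w * f ∈ N₆ := by
    refine mul_mem_of_span_le (s := {1, u, v, w, u ^ 2}) ?_ hf
    simp only [Set.mem_insert_iff, Set.mem_singleton_iff, forall_eq_or_imp, forall_eq]
    refine ⟨by rwa [mul_one], by rw [mul_comm]; exact hle huw, by rwa [mul_comm],
      by rw [← sq]; exact hle hww, ?_⟩
    rw [show w * u ^ 2 = u * (u * w) by ring]
    exact hu5 huw
  have hadd {g : B} (h5 : ∀ f ∈ N₅, g * f ∈ N₆) (h3 : g * u ^ 3 ∈ N₆) {f : B} (hf : f ∈ N₆) :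
      g * f ∈ N₆ := by
    refine mul_mem_of_span_le (s := {1, u, v, w, u ^ 2, u ^ 3}) ?_ hf
    have h : ∀ m ∈ ({1, u, v, w, u ^ 2} : Set B), g * m ∈ N₆ := fun m hm =>
      h5 m (Submodule.subset_span hm)
    simp only [Set.mem_insert_iff, Set.mem_singleton_iff, forall_eq_or_imp, forall_eq] at h ⊢
    tauto
  have hu6 {f : B} (hf : f ∈ N₆) : u * f ∈ N₆ := by
    refine hadd (fun _ => hu5) ?_ hf
    -- The critical product is u⁴. It is traded for a multiple of u(vw) = w(uv), and uv is already
    -- known to lie in `N₅`.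
    have h := sub_mem (hu5 hu3) (N₆.smul_mem q (hw5 huv))
    convert h using 1
    simp only [mul_add, mul_smul_comm]
    rw [show u * (v * w) = w * (u * v) by ring]
    abel
  have hv6 {f : B} (hf : f ∈ N₆) : v * f ∈ N₆ := by
    refine hadd (fun _ => hv5) ?_ hf
    rw [show v * u ^ 3 = u * (u * (u * v)) by ring]
    exact hu6 (hu5 huv)
  have hw6 {f : B} (hf : f ∈ N₆) : w * f ∈ N₆ := by
    refine hadd (fun _ => hw5) ?_ hf
    rw [show w * u ^ 3 = u * (u * (u * w)) by ring]
    exact hu6 (hu5 huw)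
  rcases hg with rfl | rfl | rfl
  exacts [hu6 hf, hv6 hf, hw6 hf]

theorem mem_span_five {u v w f : B} (q₀ q₁ q₂ q₃ q₄ : Q)
    (h : f = algebraMap Q B q₀ + algebraMap Q B q₁ * u + algebraMap Q B q₂ * v +
      algebraMap Q B q₃ * w + algebraMap Q B q₄ * u ^ 2) :
    f ∈ Submodule.span Q {1, u, v, w, u ^ 2} := by
  have hm : ∀ m ∈ ({1, u, v, w, u ^ 2} : Set B), m ∈ Submodule.span Q {1, u, v, w, u ^ 2} :=
    fun m hm => Submodule.subset_span hm
  simp only [Set.mem_insert_iff, Set.mem_singleton_iff, forall_eq_or_imp, forall_eq] at hm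
  obtain ⟨h1, hu, hv, hw, hu2⟩ := hm
  rw [h, Algebra.algebraMap_eq_smul_one]
  simp only [← Algebra.smul_def]
  exact add_mem (add_mem (add_mem (add_mem (Submodule.smul_mem _ _ h1) (Submodule.smul_mem _ _ hu))
    (Submodule.smul_mem _ _ hv)) (Submodule.smul_mem _ _ hw)) (Submodule.smul_mem _ _ hu2)

/-- In an algebra in which the five relations `J` hold, the span of `1, u, v, w, u², u³` over the
coefficient ring is stable under multiplication by `u`, `v` and `w`. -/
theorem span_stable_of_relations {a b c d e t r : Q} (hr : 6 * r = 1) {u v w a' b' c' d' e' t' : B}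
    (ha : algebraMap Q B a = a') (hb : algebraMap Q B b = b') (hc : algebraMap Q B c = c')
    (hd : algebraMap Q B d = d') (he : algebraMap Q B e = e') (ht : algebraMap Q B t = t')
    (h32 : 6 * v * u - 3 * w * b' - 2 * v * a' * d' + w * a' ^ 2 - 4 * u ^ 2 * a'
      + 2 * u * a' ^ 2 * d' - 3 * c' * e' + 4 * b' * a' * e' - a' ^ 3 * e' + c' * d' ^ 2
      - b' * a' * d' ^ 2 = 0)
    (h23 : 6 * w * u - 3 * v * e' - 2 * w * a' * d' + v * d' ^ 2 - 4 * u ^ 2 * d'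
      + 2 * u * d' ^ 2 * a' - 3 * t' * b' + 4 * e' * d' * b' - d' ^ 3 * b' + t' * a' ^ 2
      - e' * d' * a' ^ 2 = 0)
    (h42 : 6 * v ^ 2 + u ^ 2 * b' - 3 * u ^ 2 * a' ^ 2 - 6 * c' * w + 2 * b' * w * a'
      + 4 * c' * u * d' - 2 * b' * u * a' * d' + 2 * u * a' ^ 3 * d' - 4 * v * b' * d'
      - b' ^ 2 * e' + b' ^ 2 * d' ^ 2 + 4 * b' * a' ^ 2 * e' - b' * a' ^ 2 * d' ^ 2
      - a' ^ 4 * e' - 2 * c' * a' * e' = 0)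
    (h33 : 3 * v * w - u * b' * e' + u ^ 3 + u * a' ^ 2 * e' - 5 * u ^ 2 * a' * d'
      - 3 * c' * t' + 2 * u * w * a' + b' * a' * t' - 3 * b' * w * d' + 2 * v * u * d'
      + 3 * b' * a' * e' * d' + c' * e' * d' + b' * u * d' ^ 2 - a' ^ 3 * e' * d'
      + 2 * a' ^ 2 * u * d' ^ 2 - b' * a' * d' ^ 3 - 3 * a' * v * e' = 0)
    (h24 : 6 * w ^ 2 + u ^ 2 * e' - 3 * u ^ 2 * d' ^ 2 - 6 * t' * v + 2 * e' * v * d'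
      + 4 * t' * u * a' - 2 * e' * u * a' * d' + 2 * u * d' ^ 3 * a' - 4 * w * e' * a'
      - e' ^ 2 * b' + e' ^ 2 * a' ^ 2 + 4 * e' * d' ^ 2 * b' - e' * d' ^ 2 * a' ^ 2
      - d' ^ 4 * b' - 2 * t' * d' * b' = 0)
    {g : B} (hg : g = u ∨ g = v ∨ g = w)
    {f : B} (hf : f ∈ Submodule.span Q {1, u, v, w, u ^ 2, u ^ 3}) :
    g * f ∈ Submodule.span Q {1, u, v, w, u ^ 2, u ^ 3} := by
  have hr' : 6 * algebraMap Q B r = 1 := by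
    rw [← map_ofNat (algebraMap Q B) 6, ← map_mul, hr, map_one]
  set r' := algebraMap Q B r with hr''
  have huv : u * v ∈ Submodule.span Q {1, u, v, w, u ^ 2} := by
    refine mem_span_five (r * (3 * c * e - 4 * b * a * e + a ^ 3 * e - c * d ^ 2 + b * a * d ^ 2))
      (-r * (2 * a ^ 2 * d)) (r * (2 * a * d)) (r * (3 * b - a ^ 2)) (r * (4 * a)) ?_
    simp only [map_add, map_sub, map_mul, map_pow, map_neg, map_ofNat, ha, hb, hc, hd, he,
      ← hr'']
    linear_combination r' * h32 - u * v * hr'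
  have huw : u * w ∈ Submodule.span Q {1, u, v, w, u ^ 2} := by
    refine mem_span_five (r * (3 * t * b - 4 * e * d * b + d ^ 3 * b - t * a ^ 2 + e * d * a ^ 2))
      (-r * (2 * d ^ 2 * a)) (r * (3 * e - d ^ 2)) (r * (2 * a * d)) (r * (4 * d)) ?_
    simp only [map_add, map_sub, map_mul, map_pow, map_neg, map_ofNat, ha, hb, hd, he, ht,
      ← hr'']
    linear_combination r' * h23 - u * w * hr'
  have hvv : v ^ 2 ∈ Submodule.span Q {1, u, v, w, u ^ 2} := by
    refine mem_span_five (r * (b ^ 2 * e - b ^ 2 * d ^ 2 - 4 * b * a ^ 2 * e + b * a ^ 2 * d ^ 2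
      + a ^ 4 * e + 2 * c * a * e)) (-r * (4 * c * d - 2 * b * a * d + 2 * a ^ 3 * d))
      (r * (4 * b * d)) (r * (6 * c - 2 * b * a)) (r * (3 * a ^ 2 - b)) ?_
    simp only [map_add, map_sub, map_mul, map_pow, map_neg, map_ofNat, ha, hb, hc, hd, he,
      ← hr'']
    linear_combination r' * h42 - v ^ 2 * hr'
  have hww : w ^ 2 ∈ Submodule.span Q {1, u, v, w, u ^ 2} := by
    refine mem_span_five (r * (e ^ 2 * b - e ^ 2 * a ^ 2 - 4 * e * d ^ 2 * b + e * d ^ 2 * a ^ 2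
      + d ^ 4 * b + 2 * t * d * b)) (-r * (4 * t * a - 2 * e * a * d + 2 * d ^ 3 * a))
      (r * (6 * t - 2 * e * d)) (r * (4 * e * a)) (r * (3 * d ^ 2 - e)) ?_
    simp only [map_add, map_sub, map_mul, map_pow, map_neg, map_ofNat, ha, hb, hd, he, ht,
      ← hr'']
    linear_combination r' * h24 - w ^ 2 * hr'
  have hu3 : u ^ 3 + (3 : Q) • (v * w) ∈ Submodule.span Q {1, u, v, w, u ^ 2} := by
    -- The relation of bidegree (3,3) also contains uw and uv, which are carried along here and
    -- removed by `huw` and `huv`.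
    have h : u ^ 3 + (3 : Q) • (v * w) + (2 * a) • (u * w) + (2 * d) • (u * v) ∈
        Submodule.span Q {1, u, v, w, u ^ 2} := by
      refine mem_span_five (3 * c * t - b * a * t - 3 * b * a * e * d - c * e * d + a ^ 3 * e * d
        + b * a * d ^ 3) (b * e - a ^ 2 * e - b * d ^ 2 - 2 * a ^ 2 * d ^ 2) (3 * a * e)
        (3 * b * d) (5 * a * d) ?_
      simp only [Algebra.smul_def, map_add, map_sub, map_mul, map_pow, map_ofNat, ha, hb,
        hc, hd, he, ht]
      linear_combination h33
    rw [add_assoc] at h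
    exact (Submodule.add_mem_iff_left _ (add_mem (Submodule.smul_mem _ _ huw)
      (Submodule.smul_mem _ _ huv))).1 h
  refine span_stable huv huw hvv hww ?_ hu3 hg hf
  have hle : Submodule.span Q {1, u, v, w, u ^ 2} ≤
      Submodule.span Q {1, u, v, w, u ^ 2, u ^ 3} := Submodule.span_mono fun m hm => by
    simp only [Set.mem_insert_iff, Set.mem_singleton_iff] at hm ⊢
    tauto
  -- Subtracting u³ leaves 3vw, and 2r · 3 = 6r = 1.
  have h := Submodule.smul_mem _ (2 * r) (sub_mem (hle hu3)
    (Submodule.subset_span (by simp : u ^ 3 ∈ ({1, u, v, w, u ^ 2, u ^ 3} : Set B))))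
  convert h using 1
  simp only [Algebra.smul_def, map_mul, map_ofNat, ← hr'']
  linear_combination -v * w * hr'

end Reduction

/-- The variable of `F₁` with label `v`. -/
def T₁ (v : Label) (h : v ≠ .y3 := by decide) : F₁ K := X ⟨v, h⟩

/-- The element of `F₁` substituted for `T_{y³}`. -/
def y3Value : F₁ K :=
  3 * T₁ K .S ^ 2 + C (3 / 2) * T₁ K .y2 * T₁ K .y - C (1 / 2) * T₁ K .y ^ 3

/-- The inclusion in `F₁` of the polynomial ring on the parameters
`T_x, T_{x²}, T_{x³}, T_y, T_{y²}, S`. -/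
def paramIncl : MvPolynomial (Fin 6) K →ₐ[K] F₁ K :=
  aeval ![T₁ K .x, T₁ K .x2, T₁ K .x3, T₁ K .y, T₁ K .y2, T₁ K .S]

/-- The elements `1, u, v, w, u², u³` for `u = T_{xy}`, `v = T_{x²y}`, `w = T_{xy²}`. -/
def moduleGens : Fin 6 → F₁ K :=
  ![1, T₁ K .xy, T₁ K .x2y, T₁ K .xy2, T₁ K .xy ^ 2, T₁ K .xy ^ 3]

theorem subst_T_y3 : subst K (T K .y3) = y3Value K := aeval_X _ _

theorem subst_T₁ (v : Label) (h : v ≠ .y3) : subst K (T K v) = T₁ K v h := subst_T K h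

/-- The span of the images of the six elements contains 1 and is stable under all nine variables:
the parameters act as scalars, and u, v, w are covered by `span_stable_of_relations`. So it contains
the image of every polynomial. -/
theorem exists_reduction_aux (h6 : (6 : K) ≠ 0) {B : Type*} [CommRing B] (π : F₁ K →+* B)
    (hJ : ∀ i, π (Jtilde K i) = 0) (f : F₁ K) :
    ∃ q : Fin 6 → MvPolynomial (Fin 6) K, π f = π (∑ i, paramIncl K (q i) * moduleGens K i) := by
  -- The target becomes an algebra over the parameter ring along π, so scalar multiplication is
  -- multiplication by images of parameters.
  let : Algebra (MvPolynomial (Fin 6) K) B := (π.comp (paramIncl K).toRingHom).toAlgebra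
  have halg (q : MvPolynomial (Fin 6) K) : algebraMap _ B q = π (paramIncl K q) := rfl
  have hC (c : K) : paramIncl K (C c) = C c := (paramIncl K).commutes c
  have hX (i : Fin 6) : paramIncl K (X i) =
      ![T₁ K .x, T₁ K .x2, T₁ K .x3, T₁ K .y, T₁ K .y2, T₁ K .S] i := aeval_X _ _
  have sx := subst_T₁ K .x (by decide)
  have sx2 := subst_T₁ K .x2 (by decide)
  have sx3 := subst_T₁ K .x3 (by decide)
  have sy := subst_T₁ K .y (by decide)
  have sy2 := subst_T₁ K .y2 (by decide)
  have sxy := subst_T₁ K .xy (by decide)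
  have sx2y := subst_T₁ K .x2y (by decide)
  have sxy2 := subst_T₁ K .xy2 (by decide)
  let t : MvPolynomial (Fin 6) K := 3 * X 5 ^ 2 + C (3 / 2) * X 4 * X 3 - C (1 / 2) * X 3 ^ 3
  have ht : algebraMap _ B t = π (y3Value K) := by
    rw [halg]
    simp only [t, map_add, map_sub, map_mul, map_pow, map_ofNat, hC, hX, y3Value]
    rfl
  have hr : (6 : MvPolynomial (Fin 6) K) * C (1 / 6) = 1 := by
    rw [show (6 : MvPolynomial (Fin 6) K) = C 6 from (map_ofNat C 6).symm, ← C_mul,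
      mul_one_div_cancel h6, C_1]
  have stable {g : B} := span_stable_of_relations (g := g) (t := t) hr
    (u := π (T₁ K .xy)) (v := π (T₁ K .x2y)) (w := π (T₁ K .xy2))
    (show algebraMap _ B (X 0) = π (T₁ K .x) by rw [halg, hX]; rfl)
    (show algebraMap _ B (X 1) = π (T₁ K .x2) by rw [halg, hX]; rfl)
    (show algebraMap _ B (X 2) = π (T₁ K .x3) by rw [halg, hX]; rfl)
    (show algebraMap _ B (X 3) = π (T₁ K .y) by rw [halg, hX]; rfl)
    (show algebraMap _ B (X 4) = π (T₁ K .y2) by rw [halg, hX]; rfl)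
    ht
    (by
      have h : π (subst K (J32 K)) = 0 := hJ 0
      simpa only [J32, map_add, map_sub, map_mul, map_pow, map_ofNat, subst_T_y3,
        sx, sx2, sx3, sy, sy2, sxy, sx2y, sxy2] using h)
    (by
      have h : π (subst K (J23 K)) = 0 := hJ 1
      simpa only [J23, map_add, map_sub, map_mul, map_pow, map_ofNat, subst_T_y3,
        sx, sx2, sx3, sy, sy2, sxy, sx2y, sxy2] using h)
    (by
      have h : π (subst K (J42 K)) = 0 := hJ 2
      simpa only [J42, map_add, map_sub, map_mul, map_pow, map_ofNat, subst_T_y3,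
        sx, sx2, sx3, sy, sy2, sxy, sx2y, sxy2] using h)
    (by
      have h : π (subst K (J33 K)) = 0 := hJ 3
      simpa only [J33, map_add, map_sub, map_mul, map_pow, map_ofNat, subst_T_y3,
        sx, sx2, sx3, sy, sy2, sxy, sx2y, sxy2] using h)
    (by
      have h : π (subst K (J24 K)) = 0 := hJ 4
      simpa only [J24, map_add, map_sub, map_mul, map_pow, map_ofNat, subst_T_y3,
        sx, sx2, sx3, sy, sy2, sxy, sx2y, sxy2] using h)
  set N : Submodule (MvPolynomial (Fin 6) K) B := Submodule.span _
    {1, π (T₁ K .xy), π (T₁ K .x2y), π (T₁ K .xy2), π (T₁ K .xy) ^ 2, π (T₁ K .xy) ^ 3} with hN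
  have hscal (q : MvPolynomial (Fin 6) K) {g : B} (hg : g ∈ N) :
      g * π (paramIncl K q) ∈ N := by
    rw [mul_comm, ← halg, ← Algebra.smul_def]
    exact N.smul_mem q hg
  have hvar (i : Fin 6) {g : B} (hg : g ∈ N) :
      g * π (![T₁ K .x, T₁ K .x2, T₁ K .x3, T₁ K .y, T₁ K .y2, T₁ K .S] i) ∈ N := by
    rw [← hX]
    exact hscal _ hg
  have hmem : π f ∈ N := by
    induction f using MvPolynomial.induction_on with
    | C c =>
      have := hscal (C c) (Submodule.subset_span (by simp) : (1 : B) ∈ N)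
      rwa [one_mul, hC] at this
    | add p q hp hq => rw [map_add]; exact add_mem hp hq
    | mul_X p v hp =>
      rw [map_mul]
      obtain ⟨v, hv⟩ := v
      cases v
      case x => exact hvar 0 hp
      case x2 => exact hvar 1 hp
      case x3 => exact hvar 2 hp
      case y => exact hvar 3 hp
      case y2 => exact hvar 4 hp
      case S => exact hvar 5 hp
      case y3 => exact absurd rfl hv
      case xy => rw [mul_comm]; exact stable (.inl rfl) hp
      case x2y => rw [mul_comm]; exact stable (.inr (.inl rfl)) hp
      case xy2 => rw [mul_comm]; exact stable (.inr (.inr rfl)) hp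
  have hrange : ({1, π (T₁ K .xy), π (T₁ K .x2y), π (T₁ K .xy2), π (T₁ K .xy) ^ 2,
      π (T₁ K .xy) ^ 3} : Set B) = Set.range (fun i => π (moduleGens K i)) := by
    ext m
    simp only [Set.mem_insert_iff, Set.mem_singleton_iff, Set.mem_range, Fin.exists_fin_succ,
      moduleGens, eq_comm (a := m)]
    simp [← map_pow]
  rw [hN, hrange, Submodule.mem_span_range_iff_exists_fun] at hmem
  obtain ⟨q, hq⟩ := hmem
  refine ⟨q, ?_⟩
  rw [map_sum, ← hq]
  refine Finset.sum_congr rfl fun i _ => ?_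
  rw [map_mul, Algebra.smul_def, halg]

/-- Modulo the five relations, `F₁` is spanned by `1, u, v, w, u², u³` over the parameters. -/
theorem exists_reduction (h6 : (6 : K) ≠ 0) (f : F₁ K) :
    ∃ q : Fin 6 → MvPolynomial (Fin 6) K,
      f - ∑ i, paramIncl K (q i) * moduleGens K i ∈ Ideal.span (Set.range (Jtilde K)) := by
  obtain ⟨q, hq⟩ := exists_reduction_aux K h6 (Ideal.Quotient.mk (Ideal.span (Set.range (Jtilde K))))
    (fun i => Ideal.Quotient.eq_zero_iff_mem.2 (Ideal.subset_span ⟨i, rfl⟩)) f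
  exact ⟨q, Ideal.Quotient.eq.1 hq⟩

/-! ### Prescribing the values of the x_i and z_i. -/

section EvalXZ

variable {P : Type*} [CommRing P] [Algebra K P]

/-- The `K`-algebra homomorphism `R → P` with `x_i ↦ 2 ξ i` and `z_i ↦ 2 ζ i`. -/
def pairEval (ξ ζ : Fin 3 → P) : R K →ₐ[K] P :=
  aeval fun p =>
    if p = pair 0 1 (by decide) then ξ 0 + ζ 0
    else if p = pair 2 3 (by decide) then ξ 0 - ζ 0
    else if p = pair 0 2 (by decide) then ξ 1 + ζ 1
    else if p = pair 1 3 (by decide) then ξ 1 - ζ 1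
    else if p = pair 0 3 (by decide) then ξ 2 + ζ 2
    else ξ 2 - ζ 2

theorem pairEval_X (ξ ζ : Fin 3 → P) :
    pairEval K ξ ζ (X (pair 0 1 (by decide))) = ξ 0 + ζ 0 ∧
    pairEval K ξ ζ (X (pair 2 3 (by decide))) = ξ 0 - ζ 0 ∧
    pairEval K ξ ζ (X (pair 0 2 (by decide))) = ξ 1 + ζ 1 ∧
    pairEval K ξ ζ (X (pair 1 3 (by decide))) = ξ 1 - ζ 1 ∧
    pairEval K ξ ζ (X (pair 0 3 (by decide))) = ξ 2 + ζ 2 ∧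
    pairEval K ξ ζ (X (pair 1 2 (by decide))) = ξ 2 - ζ 2 := by
  simp only [pairEval, aeval_X]
  refine ⟨?_, ?_, ?_, ?_, ?_, ?_⟩ <;>
  · repeat rw [if_neg (by decide)]
    try rw [if_true]

theorem pairEval_xs (ξ ζ : Fin 3 → P) (i : Fin 3) : pairEval K ξ ζ (xs K i) = 2 * ξ i := by
  obtain ⟨h1, h2, h3, h4, h5, h6⟩ := pairEval_X K ξ ζ
  fin_cases i
  · refine (map_add _ _ _).trans ?_
    rw [h1, h2]; dsimp; ring
  · refine (map_add _ _ _).trans ?_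
    rw [h3, h4]; dsimp; ring
  · refine (map_add _ _ _).trans ?_
    rw [h5, h6]; dsimp; ring

theorem pairEval_zs (ξ ζ : Fin 3 → P) (i : Fin 3) : pairEval K ξ ζ (zs K i) = 2 * ζ i := by
  obtain ⟨h1, h2, h3, h4, h5, h6⟩ := pairEval_X K ξ ζ
  fin_cases i
  · refine (map_sub _ _ _).trans ?_
    rw [h1, h2]; dsimp; ring
  · refine (map_sub _ _ _).trans ?_
    rw [h3, h4]; dsimp; ring
  · refine (map_sub _ _ _).trans ?_
    rw [h5, h6]; dsimp; ring

/-- The `K`-algebra homomorphism `R → P` with `x_i ↦ ξ i` and `z_i ↦ ζ i` (for `2 ≠ 0`). -/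
def evalXZ (ξ ζ : Fin 3 → P) : R K →ₐ[K] P :=
  pairEval K (fun i => algebraMap K P (1 / 2) * ξ i) (fun i => algebraMap K P (1 / 2) * ζ i)

variable {K} in
theorem two_mul_half (h2 : (2 : K) ≠ 0) (a : P) : 2 * (algebraMap K P (1 / 2) * a) = a := by
  rw [← mul_assoc, ← map_ofNat (algebraMap K P) 2, ← map_mul, mul_one_div_cancel h2, map_one,
    one_mul]

theorem evalXZ_xs (h2 : (2 : K) ≠ 0) (ξ ζ : Fin 3 → P) (i : Fin 3) :
    evalXZ K ξ ζ (xs K i) = ξ i := (pairEval_xs K _ _ i).trans (two_mul_half h2 _)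

theorem evalXZ_zs (h2 : (2 : K) ≠ 0) (ξ ζ : Fin 3 → P) (i : Fin 3) :
    evalXZ K ξ ζ (zs K i) = ζ i := (pairEval_zs K _ _ i).trans (two_mul_half h2 _)

theorem evalXZ_phiVar (h2 : (2 : K) ≠ 0) (ξ ζ : Fin 3 → P) {v : Label} (h : v ≠ .S) :
    evalXZ K ξ ζ (phiVar K v) = ∑ i, labelValue (ξ i) (ζ i ^ 2) v := by
  rw [phiVar_eq K h, map_sum]
  refine Finset.sum_congr rfl fun i _ => ?_
  cases v <;> simp only [labelValue, map_mul, map_pow, map_zero, evalXZ_xs K h2, evalXZ_zs K h2]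

theorem evalXZ_phiVar_S (h2 : (2 : K) ≠ 0) (ξ ζ : Fin 3 → P) :
    evalXZ K ξ ζ (phiVar K .S) = ζ 0 * ζ 1 * ζ 2 := by
  simp only [phiVar_S, map_mul, evalXZ_zs K h2]

end EvalXZ

/-! ### Linear independence over the parameters, and the kernel. -/

/-- The values of the six parameters at `(ξ, ζ)`. -/
def paramValue {P : Type*} [CommRing P] (ξ ζ : Fin 3 → P) : Fin 6 → P :=
  ![ξ 0 + ξ 1 + ξ 2, ξ 0 ^ 2 + ξ 1 ^ 2 + ξ 2 ^ 2, ξ 0 ^ 3 + ξ 1 ^ 3 + ξ 2 ^ 3,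
    ζ 0 ^ 2 + ζ 1 ^ 2 + ζ 2 ^ 2, (ζ 0 ^ 2) ^ 2 + (ζ 1 ^ 2) ^ 2 + (ζ 2 ^ 2) ^ 2, ζ 0 * ζ 1 * ζ 2]

theorem evalXZ_param {P : Type*} [CommRing P] [Algebra K P] (h2 : (2 : K) ≠ 0) (ξ ζ : Fin 3 → P)
    (q : MvPolynomial (Fin 6) K) :
    evalXZ K ξ ζ (phi₁ K (paramIncl K q)) = aeval (paramValue ξ ζ) q := by
  have h : ((evalXZ K ξ ζ).comp (phi₁ K)).comp (paramIncl K) = aeval (paramValue ξ ζ) := by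
    apply MvPolynomial.algHom_ext
    intro i
    rw [AlgHom.comp_apply, AlgHom.comp_apply, paramIncl, aeval_X, aeval_X]
    fin_cases i
    all_goals
      refine (congrArg _ (phi₁_X K _)).trans ?_
      first
      | exact evalXZ_phiVar_S K h2 ξ ζ
      | exact (evalXZ_phiVar K h2 ξ ζ (by decide)).trans (Fin.sum_univ_three _)
  exact DFunLike.congr_fun h q

theorem isIntegral_of_cubic {Q A : Type*} [CommRing Q] [CommRing A] [Algebra Q A] {t : A}
    (a b c : Q) (h : t ^ 3 + algebraMap Q A a * t ^ 2 + algebraMap Q A b * t + algebraMap Q A c = 0) :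
    IsIntegral Q t := by
  nontriviality Q
  refine ⟨Polynomial.X ^ 3 + Polynomial.C a * Polynomial.X ^ 2 + Polynomial.C b * Polynomial.X +
    Polynomial.C c, by monicity!, ?_⟩
  simpa using h

/-- The generic values of the parameters are algebraically independent. -/
theorem paramValue_algebraicIndependent (h2 : (2 : K) ≠ 0) (h3 : (3 : K) ≠ 0) :
    AlgebraicIndependent K (paramValue (fun i => (X (.inl i) : MvPolynomial (Fin 3 ⊕ Fin 3) K))
      (fun i => X (.inr i))) := by
  set p := paramValue (fun i => (X (.inl i) : MvPolynomial (Fin 3 ⊕ Fin 3) K))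
    (fun i => X (.inr i)) with hp
  let Q := Algebra.adjoin K (Set.range p)
  let q (i : Fin 6) : Q := ⟨p i, Algebra.subset_adjoin ⟨i, rfl⟩⟩
  have hq (i : Fin 6) : algebraMap Q (MvPolynomial (Fin 3 ⊕ Fin 3) K) (q i) = p i := rfl
  have hc (c : K) : algebraMap Q (MvPolynomial (Fin 3 ⊕ Fin 3) K) (algebraMap K Q c) = C c := rfl
  have half : (2 : MvPolynomial (Fin 3 ⊕ Fin 3) K) * C (1 / 2) = 1 := by
    rw [show (2 : MvPolynomial (Fin 3 ⊕ Fin 3) K) = C 2 from (map_ofNat C 2).symm, ← C_mul,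
      mul_one_div_cancel h2, C_1]
  have third : (3 : MvPolynomial (Fin 3 ⊕ Fin 3) K) * C (1 / 3) = 1 := by
    rw [show (3 : MvPolynomial (Fin 3 ⊕ Fin 3) K) = C 3 from (map_ofNat C 3).symm, ← C_mul,
      mul_one_div_cancel h3, C_1]
  set r : MvPolynomial (Fin 3 ⊕ Fin 3) K := C (1 / 2)
  set s : MvPolynomial (Fin 3 ⊕ Fin 3) K := C (1 / 3)
  have p0 : p 0 = X (.inl 0) + X (.inl 1) + X (.inl 2) := rfl
  have p1 : p 1 = X (.inl 0) ^ 2 + X (.inl 1) ^ 2 + X (.inl 2) ^ 2 := rfl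
  have p2 : p 2 = X (.inl 0) ^ 3 + X (.inl 1) ^ 3 + X (.inl 2) ^ 3 := rfl
  have p3 : p 3 = X (.inr 0) ^ 2 + X (.inr 1) ^ 2 + X (.inr 2) ^ 2 := rfl
  have p4 : p 4 = (X (.inr 0) ^ 2) ^ 2 + (X (.inr 1) ^ 2) ^ 2 + (X (.inr 2) ^ 2) ^ 2 := rfl
  have p5 : p 5 = X (.inr 0) * X (.inr 1) * X (.inr 2) := rfl
  have hx (i : Fin 3) : IsIntegral Q (X (.inl i) : MvPolynomial (Fin 3 ⊕ Fin 3) K) := by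
    -- Each x_i is a root of the cubic with roots x₁, x₂, x₃; its coefficients come from the power
    -- sums by Newton's formulas, which divide by 2 and 3.
    refine isIntegral_of_cubic (-q 0) (algebraMap K Q (1 / 2) * (q 0 ^ 2 - q 1))
      (-algebraMap K Q (1 / 3) * (q 2 - q 0 * q 1 +
        q 0 * (algebraMap K Q (1 / 2) * (q 0 ^ 2 - q 1)))) ?_
    simp only [map_neg, map_mul, map_sub, map_add, map_pow, hq, hc]
    have he2 : r * (p 0 ^ 2 - p 1) = X (.inl 0) * X (.inl 1) + X (.inl 0) * X (.inl 2) +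
        X (.inl 1) * X (.inl 2) := by
      rw [p0, p1]
      linear_combination (X (.inl 0) * X (.inl 1) + X (.inl 0) * X (.inl 2) +
        X (.inl 1) * X (.inl 2)) * half
    rw [he2, p0, p1, p2]
    generalize hg : (X (.inl i) : MvPolynomial (Fin 3 ⊕ Fin 3) K) = g
    have hz : (g - X (.inl 0)) * (g - X (.inl 1)) * (g - X (.inl 2)) = 0 := by
      subst hg
      fin_cases i <;> simp
    linear_combination hz - X (.inl 0) * X (.inl 1) * X (.inl 2) * third
  have hz (i : Fin 3) : IsIntegral Q (X (.inr i) : MvPolynomial (Fin 3 ⊕ Fin 3) K) := by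
    -- Here z_i² is a root of the cubic with roots z₁², z₂², z₃². Its constant term is −S², so the
    -- third power sum is not needed.
    refine IsIntegral.of_pow (n := 2) (by decide) ?_
    refine isIntegral_of_cubic (-q 3) (algebraMap K Q (1 / 2) * (q 3 ^ 2 - q 4)) (-q 5 ^ 2) ?_
    simp only [map_neg, map_mul, map_sub, map_pow, hq, hc]
    have he2 : r * (p 3 ^ 2 - p 4) = X (.inr 0) ^ 2 * X (.inr 1) ^ 2 +
        X (.inr 0) ^ 2 * X (.inr 2) ^ 2 + X (.inr 1) ^ 2 * X (.inr 2) ^ 2 := by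
      rw [p3, p4]
      linear_combination (X (.inr 0) ^ 2 * X (.inr 1) ^ 2 +
        X (.inr 0) ^ 2 * X (.inr 2) ^ 2 + X (.inr 1) ^ 2 * X (.inr 2) ^ 2) * half
    rw [he2, p3, p5]
    generalize hg : (X (.inr i) : MvPolynomial (Fin 3 ⊕ Fin 3) K) = g
    have hz : (g ^ 2 - X (.inr 0) ^ 2) * (g ^ 2 - X (.inr 1) ^ 2) * (g ^ 2 - X (.inr 2) ^ 2) = 0 := by
      subst hg
      fin_cases i <;> simp
    linear_combination hz
  have hint : Algebra.IsIntegral Q (MvPolynomial (Fin 3 ⊕ Fin 3) K) := by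
    refine ⟨fun f => ?_⟩
    induction f using MvPolynomial.induction_on with
    | C c => exact isIntegral_algebraMap (x := algebraMap K Q c)
    | add f g hf hg => exact hf.add hg
    | mul_X f i hf => exact hf.mul (by rcases i with i | i; exacts [hx i, hz i])
  have halg : Algebra.IsAlgebraic Q (MvPolynomial (Fin 3 ⊕ Fin 3) K) := inferInstance
  -- Six elements over which a ring of transcendence degree six is algebraic form a transcendence
  -- basis.
  refine (Algebra.IsAlgebraic.isTranscendenceBasis_of_lift_le_trdeg_of_finite K p ?_).1
  simp

/-- Six substitutions, one for each permutation of the indices. -/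
def permTable : Fin 6 → Fin 3 → Fin 3 :=
  ![![0, 1, 2], ![1, 0, 2], ![0, 2, 1], ![2, 1, 0], ![1, 2, 0], ![2, 0, 1]]

/-- Parameters do not mix x and z, so they survive a permutation of the z_i alone. The mixed
elements u, v, w do not, which is what makes the six substitutions yield six different equations. -/
theorem paramValue_permTable {P : Type*} [CommRing P] (ξ ζ : Fin 3 → P) (k : Fin 6) :
    paramValue ξ (fun i => ζ (permTable k i)) = paramValue ξ ζ := by
  funext i
  fin_cases k <;> fin_cases i <;> simp [paramValue, permTable] <;> ring

/-- The integer matrix of values of `1, u, v, w, u², u³` at `x = (0, 1, -1)` and the six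
permutations of `z = (0, 1, 2)`. -/
def valueMatrix : Matrix (Fin 6) (Fin 6) ℤ :=
  !![1, -3, 5, -15, 9, -27; 1, -4, 4, -16, 16, -64; 1, 3, 5, 15, 9, 27; 1, 1, 1, 1, 1, 1;
    1, 4, 4, 16, 16, 64; 1, -1, 1, -1, 1, -1]

/-- An inverse up to the factor 72 = 2³ · 3² certifies invertibility wherever 2 and 3 are
invertible. -/
theorem valueMatrix_mul : valueMatrix * !![-12, 4, -12, 44, 4, 44; 4, -1, -4, 44, 1, -44;
    15, -8, 15, -7, -8, -7; -5, 2, 5, -7, -2, 7; -3, 4, -3, -1, 4, -1; 1, -1, -1, -1, 1, 1] =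
    (72 : ℤ) • (1 : Matrix (Fin 6) (Fin 6) ℤ) := by
  decide

theorem valueMatrix_det_ne_zero (h2 : (2 : K) ≠ 0) (h3 : (3 : K) ≠ 0) :
    ((valueMatrix.det : ℤ) : K) ≠ 0 := by
  intro h
  have h' := congrArg (fun M => ((Matrix.det M : ℤ) : K)) valueMatrix_mul
  simp only [Matrix.det_mul, Int.cast_mul, h, zero_mul, Matrix.det_smul, Matrix.det_one,
    Fintype.card_fin, mul_one, Int.cast_pow] at h'
  have h72 : ((72 : ℤ) : K) = 2 ^ 3 * 3 ^ 2 := by norm_num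
  rw [h72] at h'
  exact pow_ne_zero 6 (mul_ne_zero (pow_ne_zero 3 h2) (pow_ne_zero 2 h3)) h'.symm

/-- The matrix of the values of `1, u, v, w, u², u³` under the six substitutions. -/
def genericMatrix : Matrix (Fin 6) (Fin 6) (MvPolynomial (Fin 3 ⊕ Fin 3) K) := fun k i =>
  evalXZ K (fun j => X (.inl j)) (fun j => X (.inr (permTable k j))) (phi₁ K (moduleGens K i))

theorem genericMatrix_eval (h2 : (2 : K) ≠ 0) :
    (aeval (Sum.elim ![0, 1, -1] ![0, 1, 2]) : MvPolynomial (Fin 3 ⊕ Fin 3) K →ₐ[K]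
      K).toRingHom.mapMatrix (genericMatrix K) = (Int.castRingHom K).mapMatrix valueMatrix := by
  have hu (k : Fin 6) := evalXZ_phiVar K h2 (fun j => (X (.inl j) : MvPolynomial (Fin 3 ⊕ Fin 3) K))
    (fun j => X (.inr (permTable k j))) (v := .xy) (by decide)
  have hv (k : Fin 6) := evalXZ_phiVar K h2 (fun j => (X (.inl j) : MvPolynomial (Fin 3 ⊕ Fin 3) K))
    (fun j => X (.inr (permTable k j))) (v := .x2y) (by decide)
  have hw (k : Fin 6) := evalXZ_phiVar K h2 (fun j => (X (.inl j) : MvPolynomial (Fin 3 ⊕ Fin 3) K))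
    (fun j => X (.inr (permTable k j))) (v := .xy2) (by decide)
  simp only [Fin.sum_univ_three, labelValue] at hu hv hw
  have key (k i : Fin 6) : (aeval (Sum.elim ![0, 1, -1] ![0, 1, 2]) :
      MvPolynomial (Fin 3 ⊕ Fin 3) K →ₐ[K] K) (genericMatrix K k i) = (valueMatrix k i : K) := by
    unfold genericMatrix
    fin_cases i <;> simp [moduleGens, T₁, phi₁_X, hu, hv, hw] <;> fin_cases k <;>
      simp [permTable, valueMatrix] <;> norm_num
  ext k i
  exact key k i

/-- A determinant that is nonzero after specialization is nonzero. -/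
theorem genericMatrix_det_ne_zero (h2 : (2 : K) ≠ 0) (h3 : (3 : K) ≠ 0) :
    (genericMatrix K).det ≠ 0 := by
  intro h
  have h' := congrArg Matrix.det (genericMatrix_eval K h2)
  rw [← RingHom.map_det, ← RingHom.map_det, h, map_zero] at h'
  exact valueMatrix_det_ne_zero K h2 h3 h'.symm

/-- The elements `1, u, v, w, u², u³` are linearly independent over the parameters. -/
theorem eq_zero_of_phi₁_eq_zero (h2 : (2 : K) ≠ 0) (h3 : (3 : K) ≠ 0)
    (q : Fin 6 → MvPolynomial (Fin 6) K)
    (h : phi₁ K (∑ i, paramIncl K (q i) * moduleGens K i) = 0) : q = 0 := by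
  have h0 : (fun i => aeval (paramValue (fun i => (X (.inl i) : MvPolynomial (Fin 3 ⊕ Fin 3) K))
      (fun i => X (.inr i))) (q i)) = 0 := by
    -- Each substitution fixes the coefficients, so the coefficient vector is killed by the whole
    -- matrix.
    refine Matrix.eq_zero_of_mulVec_eq_zero (genericMatrix_det_ne_zero K h2 h3) ?_
    funext k
    have hk := congrArg (evalXZ K (fun j => (X (.inl j) : MvPolynomial (Fin 3 ⊕ Fin 3) K))
      (fun j => X (.inr (permTable k j)))) h
    rw [map_zero, map_sum, map_sum] at hk
    rw [Matrix.mulVec, dotProduct]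
    refine Eq.trans (Finset.sum_congr rfl fun i _ => ?_) hk
    rw [map_mul, map_mul, evalXZ_param K h2,
      paramValue_permTable _ (fun j => (X (.inr j) : MvPolynomial (Fin 3 ⊕ Fin 3) K)), mul_comm]
    rfl
  funext i
  exact (paramValue_algebraicIndependent K h2 h3).eq_zero_of_aeval_eq_zero _ (congrFun h0 i)

/-- Reduce an element of the kernel to a combination of the six module generators; independence
makes that combination vanish, so the element itself lies in the ideal of the relations. -/
theorem ker_phi₁ (h2 : (2 : K) ≠ 0) (h3 : (3 : K) ≠ 0) :
    Ideal.span (Set.range (Jtilde K)) = RingHom.ker (phi₁ K) := by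
  have hle : Ideal.span (Set.range (Jtilde K)) ≤ RingHom.ker (phi₁ K) :=
    Ideal.span_le.2 (Set.range_subset_iff.2 (phi₁_Jtilde K h2))
  refine le_antisymm hle fun f hf => ?_
  have h6 : (6 : K) ≠ 0 := by
    rw [show (6 : K) = 2 * 3 by norm_num]
    exact mul_ne_zero h2 h3
  obtain ⟨q, hq⟩ := exists_reduction K h6 f
  have hq' : phi₁ K f - phi₁ K (∑ i, paramIncl K (q i) * moduleGens K i) = 0 := by
    rw [← map_sub]
    exact hle hq
  rw [show phi₁ K f = 0 from hf, zero_sub, neg_eq_zero] at hq'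
  rw [eq_zero_of_phi₁_eq_zero K h2 h3 q hq'] at hq
  simpa using hq

/-! ### The action of S₄ on the x_i and z_i. -/

/-- The action of a permutation on `R`. -/
def act (σ : Equiv.Perm (Fin 4)) : R K →ₐ[K] R K := rename (permPair σ)

theorem act_mul (σ τ : Equiv.Perm (Fin 4)) (f : R K) : act K (σ * τ) f = act K σ (act K τ f) := by
  rw [act, act, act, rename_rename]
  congr 2
  funext p
  exact Subtype.ext (by simp [permPair, Finset.map_map]; rfl)

theorem act_one (f : R K) : act K 1 f = f := by
  rw [act, show permPair 1 = id from funext fun p => Subtype.ext Finset.map_refl, rename_id]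
  rfl

theorem act_pair (σ : Equiv.Perm (Fin 4)) {i j k l : Fin 4} (h : i ≠ j) (h' : k ≠ l)
    (hp : permPair σ (pair i j h) = pair k l h') :
    act K σ (X (pair i j h)) = X (pair k l h') := by
  rw [act, rename_X, hp]

/-- Among the three adjacent transpositions only this one introduces signs. There are two of them,
so z₁z₂z₃ is still fixed. -/
theorem act_swap01 :
    act K (Equiv.swap 0 1) (xs K 0) = xs K 0 ∧ act K (Equiv.swap 0 1) (xs K 1) = xs K 2 ∧
    act K (Equiv.swap 0 1) (xs K 2) = xs K 1 ∧ act K (Equiv.swap 0 1) (zs K 0) = zs K 0 ∧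
    act K (Equiv.swap 0 1) (zs K 1) = -zs K 2 ∧ act K (Equiv.swap 0 1) (zs K 2) = -zs K 1 := by
  have h1 := act_pair K (Equiv.swap 0 1) (i := 0) (j := 1) (k := 0) (l := 1) (by decide) (by decide)
    (by decide)
  have h2 := act_pair K (Equiv.swap 0 1) (i := 2) (j := 3) (k := 2) (l := 3) (by decide) (by decide)
    (by decide)
  have h3 := act_pair K (Equiv.swap 0 1) (i := 0) (j := 2) (k := 1) (l := 2) (by decide) (by decide)
    (by decide)
  have h4 := act_pair K (Equiv.swap 0 1) (i := 1) (j := 3) (k := 0) (l := 3) (by decide) (by decide)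
    (by decide)
  have h5 := act_pair K (Equiv.swap 0 1) (i := 0) (j := 3) (k := 1) (l := 3) (by decide) (by decide)
    (by decide)
  have h6 := act_pair K (Equiv.swap 0 1) (i := 1) (j := 2) (k := 0) (l := 2) (by decide) (by decide)
    (by decide)
  simp only [xs, zs, Matrix.cons_val, map_add, map_sub, h1, h2, h3, h4, h5, h6]
  refine ⟨?_, ?_, ?_, ?_, ?_, ?_⟩ <;> first | trivial | ring

theorem act_swap12 :
    act K (Equiv.swap 1 2) (xs K 0) = xs K 1 ∧ act K (Equiv.swap 1 2) (xs K 1) = xs K 0 ∧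
    act K (Equiv.swap 1 2) (xs K 2) = xs K 2 ∧ act K (Equiv.swap 1 2) (zs K 0) = zs K 1 ∧
    act K (Equiv.swap 1 2) (zs K 1) = zs K 0 ∧ act K (Equiv.swap 1 2) (zs K 2) = zs K 2 := by
  have h1 := act_pair K (Equiv.swap 1 2) (i := 0) (j := 1) (k := 0) (l := 2) (by decide) (by decide)
    (by decide)
  have h2 := act_pair K (Equiv.swap 1 2) (i := 2) (j := 3) (k := 1) (l := 3) (by decide) (by decide)
    (by decide)
  have h3 := act_pair K (Equiv.swap 1 2) (i := 0) (j := 2) (k := 0) (l := 1) (by decide) (by decide)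
    (by decide)
  have h4 := act_pair K (Equiv.swap 1 2) (i := 1) (j := 3) (k := 2) (l := 3) (by decide) (by decide)
    (by decide)
  have h5 := act_pair K (Equiv.swap 1 2) (i := 0) (j := 3) (k := 0) (l := 3) (by decide) (by decide)
    (by decide)
  have h6 := act_pair K (Equiv.swap 1 2) (i := 1) (j := 2) (k := 1) (l := 2) (by decide) (by decide)
    (by decide)
  simp only [xs, zs, Matrix.cons_val, map_add, map_sub, h1, h2, h3, h4, h5, h6]
  refine ⟨?_, ?_, ?_, ?_, ?_, ?_⟩ <;> trivial

theorem act_swap23 :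
    act K (Equiv.swap 2 3) (xs K 0) = xs K 0 ∧ act K (Equiv.swap 2 3) (xs K 1) = xs K 2 ∧
    act K (Equiv.swap 2 3) (xs K 2) = xs K 1 ∧ act K (Equiv.swap 2 3) (zs K 0) = zs K 0 ∧
    act K (Equiv.swap 2 3) (zs K 1) = zs K 2 ∧ act K (Equiv.swap 2 3) (zs K 2) = zs K 1 := by
  have h1 := act_pair K (Equiv.swap 2 3) (i := 0) (j := 1) (k := 0) (l := 1) (by decide) (by decide)
    (by decide)
  have h2 := act_pair K (Equiv.swap 2 3) (i := 2) (j := 3) (k := 2) (l := 3) (by decide) (by decide)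
    (by decide)
  have h3 := act_pair K (Equiv.swap 2 3) (i := 0) (j := 2) (k := 0) (l := 3) (by decide) (by decide)
    (by decide)
  have h4 := act_pair K (Equiv.swap 2 3) (i := 1) (j := 3) (k := 1) (l := 2) (by decide) (by decide)
    (by decide)
  have h5 := act_pair K (Equiv.swap 2 3) (i := 0) (j := 3) (k := 0) (l := 2) (by decide) (by decide)
    (by decide)
  have h6 := act_pair K (Equiv.swap 2 3) (i := 1) (j := 2) (k := 1) (l := 3) (by decide) (by decide)
    (by decide)
  simp only [xs, zs, Matrix.cons_val, map_add, map_sub, h1, h2, h3, h4, h5, h6]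
  refine ⟨?_, ?_, ?_, ?_, ?_, ?_⟩ <;> trivial

theorem act_swap_phiVar (i : Fin 3) (v : Label) :
    act K (Equiv.swap i.castSucc i.succ) (phiVar K v) = phiVar K v := by
  fin_cases i
  · obtain ⟨h1, h2, h3, h4, h5, h6⟩ := act_swap01 K
    change act K (Equiv.swap 0 1) _ = _
    cases v <;> simp only [phiVar_x, phiVar_x2, phiVar_x3, phiVar_y, phiVar_y2, phiVar_y3,
      phiVar_xy, phiVar_x2y, phiVar_xy2, phiVar_S, map_add, map_mul, map_pow, h1, h2, h3, h4, h5,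
      h6] <;> ring
  · obtain ⟨h1, h2, h3, h4, h5, h6⟩ := act_swap12 K
    change act K (Equiv.swap 1 2) _ = _
    cases v <;> simp only [phiVar_x, phiVar_x2, phiVar_x3, phiVar_y, phiVar_y2, phiVar_y3,
      phiVar_xy, phiVar_x2y, phiVar_xy2, phiVar_S, map_add, map_mul, map_pow, h1, h2, h3, h4, h5,
      h6] <;> ring
  · obtain ⟨h1, h2, h3, h4, h5, h6⟩ := act_swap23 K
    change act K (Equiv.swap 2 3) _ = _
    cases v <;> simp only [phiVar_x, phiVar_x2, phiVar_x3, phiVar_y, phiVar_y2, phiVar_y3,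
      phiVar_xy, phiVar_x2y, phiVar_xy2, phiVar_S, map_add, map_mul, map_pow, h1, h2, h3, h4, h5,
      h6] <;> ring

theorem phiVar_mem_invariants (v : Label) : phiVar K v ∈ invariants K := by
  intro σ
  change act K σ (phiVar K v) = phiVar K v
  have hσ : σ ∈ Submonoid.closure (Set.range fun i : Fin 3 =>
      Equiv.swap i.castSucc i.succ) := by
    rw [Equiv.Perm.mclosure_swap_castSucc_succ]
    trivial
  induction hσ using Submonoid.closure_induction with
  | mem σ hσ =>
    obtain ⟨i, rfl⟩ := hσ
    exact act_swap_phiVar K i v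
  | one => exact act_one K _
  | mul σ τ _ _ hσ hτ => rw [act_mul, hτ, hσ]

theorem range_le_invariants : (phi₁ K).range ≤ invariants K := by
  rintro _ ⟨f, rfl⟩
  change phi₁ K f ∈ invariants K
  induction f using MvPolynomial.induction_on with
  | C c => exact ((phi₁ K).commutes c).symm ▸ (invariants K).algebraMap_mem c
  | add f g hf hg => rw [map_add]; exact add_mem hf hg
  | mul_X f v hf =>
    rw [map_mul, phi₁_X]
    exact mul_mem hf (phiVar_mem_invariants K v)

/-! ### Surjectivity onto the invariants by averaging. -/

/-- The element `[x^a y^b]`, with `y = z²`. -/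
def powerBracket (a b : ℕ) : R K :=
  xs K 0 ^ a * (zs K 0 ^ 2) ^ b + xs K 1 ^ a * (zs K 1 ^ 2) ^ b + xs K 2 ^ a * (zs K 2 ^ 2) ^ b

/-- The identity expressing the sum of fourfold products over three points through sums of shorter
products. -/
theorem six_mul_sum_four {A : Type*} [CommRing A] (a b c d : Fin 3 → A) :
    6 * ∑ i, a i * b i * c i * d i =
      (∑ i, a i) * (∑ i, b i) * (∑ i, c i) * (∑ i, d i)
      - (∑ i, a i * b i) * (∑ i, c i) * (∑ i, d i) - (∑ i, a i * c i) * (∑ i, b i) * (∑ i, d i)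
      - (∑ i, a i * d i) * (∑ i, b i) * (∑ i, c i) - (∑ i, b i * c i) * (∑ i, a i) * (∑ i, d i)
      - (∑ i, b i * d i) * (∑ i, a i) * (∑ i, c i) - (∑ i, c i * d i) * (∑ i, a i) * (∑ i, b i)
      + (∑ i, a i * b i) * (∑ i, c i * d i) + (∑ i, a i * c i) * (∑ i, b i * d i)
      + (∑ i, a i * d i) * (∑ i, b i * c i)
      + 2 * ((∑ i, a i * b i * c i) * (∑ i, d i) + (∑ i, a i * b i * d i) * (∑ i, c i)
        + (∑ i, a i * c i * d i) * (∑ i, b i) + (∑ i, b i * c i * d i) * (∑ i, a i)) := by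
  simp only [Fin.sum_univ_three]
  ring

/-- Split the monomial into four nonconstant factors a, b, c, d. The sum of a_i b_j c_k d_l over
distinct indices is empty for three points, and inclusion–exclusion over set partitions turns this
into `six_mul_sum_four`. All terms other than the full product involve power sums of at most three
of the factors, hence of smaller degree. -/
theorem powerBracket_mem_step {B : Subalgebra K (R K)} (h6 : (6 : K) ≠ 0) {n : ℕ}
    (ih : ∀ a b, a + b < n → powerBracket K a b ∈ B) (a b : Fin 4 → ℕ)
    (hpos : ∀ i, 0 < a i + b i)
    (hn : a 0 + a 1 + a 2 + a 3 + (b 0 + b 1 + b 2 + b 3) = n) :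
    powerBracket K (a 0 + a 1 + a 2 + a 3) (b 0 + b 1 + b 2 + b 3) ∈ B := by
  have hsum (a b : ℕ) : powerBracket K a b = ∑ i, xs K i ^ a * (zs K i ^ 2) ^ b := by
    rw [powerBracket, Fin.sum_univ_three]
  have h0 := hpos 0
  have h1 := hpos 1
  have h2 := hpos 2
  have h3 := hpos 3
  let m (i : Fin 4) (j : Fin 3) : R K := xs K j ^ a i * (zs K j ^ 2) ^ b i
  have e1 (i) : ∑ j, m i j = powerBracket K (a i) (b i) := (hsum _ _).symm
  have e2 (i k) : ∑ j, m i j * m k j = powerBracket K (a i + a k) (b i + b k) := by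
    rw [hsum]
    exact Finset.sum_congr rfl fun j _ => by simp only [m]; ring
  have e3 (i k l) : ∑ j, m i j * m k j * m l j =
      powerBracket K (a i + a k + a l) (b i + b k + b l) := by
    rw [hsum]
    exact Finset.sum_congr rfl fun j _ => by simp only [m]; ring
  have e4 : ∑ j, m 0 j * m 1 j * m 2 j * m 3 j =
      powerBracket K (a 0 + a 1 + a 2 + a 3) (b 0 + b 1 + b 2 + b 3) := by
    rw [hsum]
    exact Finset.sum_congr rfl fun j _ => by simp only [m]; ring
  have h := six_mul_sum_four (m 0) (m 1) (m 2) (m 3)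
  simp only [e1, e2, e3, e4] at h
  have hmem : 6 * powerBracket K (a 0 + a 1 + a 2 + a 3) (b 0 + b 1 + b 2 + b 3) ∈ B := by
    rw [h]
    refine add_mem (add_mem (add_mem (add_mem (sub_mem (sub_mem (sub_mem (sub_mem (sub_mem (sub_mem
      ?_ ?_) ?_) ?_) ?_) ?_) ?_) ?_) ?_) ?_) (mul_mem (ofNat_mem B 2)
      (add_mem (add_mem (add_mem ?_ ?_) ?_) ?_))
    all_goals repeat refine mul_mem ?_ ?_
    all_goals refine ih _ _ ?_; omega
  have := B.smul_mem hmem (1 / 6)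
  rwa [Algebra.smul_def, ← mul_assoc, ← map_ofNat (algebraMap K (R K)) 6, ← map_mul,
    one_div_mul_cancel h6, map_one, one_mul] at this

theorem powerBracket_mem (h2 : (2 : K) ≠ 0) (h3 : (3 : K) ≠ 0) (a b : ℕ) :
    powerBracket K a b ∈ (phi₁ K).range := by
  have h6 : (6 : K) ≠ 0 := by
    rw [show (6 : K) = 2 * 3 by norm_num]
    exact mul_ne_zero h2 h3
  have hvar (v : Label) : phiVar K v ∈ (phi₁ K).range :=
    ⟨subst K (T K v), (DFunLike.congr_fun (phi₁_comp_subst K h2) (T K v)).trans (phi_T K v)⟩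
  induction hn : a + b using Nat.strong_induction_on generalizing a b with
  | _ n ih =>
  by_cases h4 : n < 4
  · have ha : a < 4 := by omega
    have hb : b < 4 := by omega
    clear ih
    interval_cases a <;> interval_cases b <;> try omega
    · have : powerBracket K 0 0 = 3 := by simp [powerBracket]; norm_num
      rw [this]
      exact ofNat_mem _ 3
    · convert hvar .y using 1; rw [phiVar_y, powerBracket]; ring
    · convert hvar .y2 using 1; rw [phiVar_y2, powerBracket]; ring
    · convert hvar .y3 using 1; rw [phiVar_y3, powerBracket]; ring
    · convert hvar .x using 1; rw [phiVar_x, powerBracket]; ring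
    · convert hvar .xy using 1; rw [phiVar_xy, powerBracket]; ring
    · convert hvar .xy2 using 1; rw [phiVar_xy2, powerBracket]; ring
    · convert hvar .x2 using 1; rw [phiVar_x2, powerBracket]; ring
    · convert hvar .x2y using 1; rw [phiVar_x2y, powerBracket]; ring
    · convert hvar .x3 using 1; rw [phiVar_x3, powerBracket]; ring
  · have ih' : ∀ a b, a + b < n → powerBracket K a b ∈ (phi₁ K).range := fun a b h => ih _ h a b rfl
    have step := powerBracket_mem_step K h6 ih'
    -- The first three factors are single variables, taken from the x's while these last and then
    -- from the y's; the fourth factor is the remainder, nonconstant because the degree is at least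
    -- 4.
    have hcase : a = 0 ∨ a = 1 ∨ a = 2 ∨ 3 ≤ a := by omega
    have key (a' b' : Fin 4 → ℕ) (hpos : ∀ i, 0 < a' i + b' i)
        (ha : a' 0 + a' 1 + a' 2 + a' 3 = a) (hb : b' 0 + b' 1 + b' 2 + b' 3 = b) :
        powerBracket K a b ∈ (phi₁ K).range := by
      have := step a' b' hpos (by omega)
      rwa [ha, hb] at this
    rcases hcase with rfl | rfl | rfl | h
    · refine key ![0, 0, 0, 0] ![1, 1, 1, b - 3] ?_ (by simp) (by simp; omega)
      simp [Fin.forall_fin_succ]; omega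
    · refine key ![1, 0, 0, 0] ![0, 1, 1, b - 2] ?_ (by simp) (by simp; omega)
      simp [Fin.forall_fin_succ]; omega
    · refine key ![1, 1, 0, 0] ![0, 0, 1, b - 1] ?_ (by simp) (by simp; omega)
      simp [Fin.forall_fin_succ]; omega
    · refine key ![1, 1, 1, a - 3] ![0, 0, 0, b] ?_ (by simp; omega) (by simp)
      simp [Fin.forall_fin_succ]; omega

/-- The sum of `g` over the three even sign changes of `z` and the identity. -/
def signSum (g : R K) : R K :=
  g + act K (Equiv.swap 0 1) (act K (Equiv.swap 2 3) g)
    + act K (Equiv.swap 1 2) (act K (Equiv.swap 0 1) (act K (Equiv.swap 2 3)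
      (act K (Equiv.swap 1 2) g)))
    + act K (Equiv.swap 0 1) (act K (Equiv.swap 2 3) (act K (Equiv.swap 1 2)
      (act K (Equiv.swap 0 1) (act K (Equiv.swap 2 3) (act K (Equiv.swap 1 2) g)))))

/-- The sum of `g` over the simultaneous permutations of the `x_i` and the `z_i`. -/
def permSum (g : R K) : R K :=
  g + act K (Equiv.swap 1 2) g + act K (Equiv.swap 2 3) g
    + act K (Equiv.swap 1 2) (act K (Equiv.swap 2 3) g)
    + act K (Equiv.swap 2 3) (act K (Equiv.swap 1 2) g)
    + act K (Equiv.swap 1 2) (act K (Equiv.swap 2 3) (act K (Equiv.swap 1 2) g))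

/-- The monomial with exponents `a` in the `x_i` and `b` in the `z_i`. -/
def xzMonomial (a b : Fin 3 → ℕ) : R K :=
  xs K 0 ^ a 0 * xs K 1 ^ a 1 * xs K 2 ^ a 2 * (zs K 0 ^ b 0 * zs K 1 ^ b 1 * zs K 2 ^ b 2)

theorem signSum_xzMonomial (a b : Fin 3 → ℕ) : signSum K (xzMonomial K a b) =
    (1 + (-1) ^ (b 1 + b 2) + (-1) ^ (b 0 + b 2) + (-1) ^ (b 0 + b 1)) * xzMonomial K a b := by
  obtain ⟨h1, h2, h3, h4, h5, h6⟩ := act_swap01 K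
  obtain ⟨i1, i2, i3, i4, i5, i6⟩ := act_swap12 K
  obtain ⟨j1, j2, j3, j4, j5, j6⟩ := act_swap23 K
  simp only [signSum, xzMonomial, map_mul, map_pow, map_neg, h1, h2, h3, h4, h5, h6, i1, i2, i3,
    i4, i5, i6, j1, j2, j3, j4, j5, j6, neg_neg]
  simp only [neg_pow (zs K _)]
  generalize xs K 0 ^ a 0 * xs K 1 ^ a 1 * xs K 2 ^ a 2 = x
  generalize zs K 0 ^ b 0 = z₀, zs K 1 ^ b 1 = z₁, zs K 2 ^ b 2 = z₂
  ring

/-- The symmetrization is a sum over distinct indices of a product of three one-point monomials;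
inclusion–exclusion writes it through power sums. -/
theorem permSum_even_mem (h2 : (2 : K) ≠ 0) (h3 : (3 : K) ≠ 0) (a b : Fin 3 → ℕ) :
    permSum K (xs K 0 ^ a 0 * xs K 1 ^ a 1 * xs K 2 ^ a 2 *
      ((zs K 0 ^ 2) ^ b 0 * (zs K 1 ^ 2) ^ b 1 * (zs K 2 ^ 2) ^ b 2)) ∈ (phi₁ K).range := by
  obtain ⟨i1, i2, i3, i4, i5, i6⟩ := act_swap12 K
  obtain ⟨j1, j2, j3, j4, j5, j6⟩ := act_swap23 K
  have hp := powerBracket_mem K h2 h3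
  have h : permSum K (xs K 0 ^ a 0 * xs K 1 ^ a 1 * xs K 2 ^ a 2 *
      ((zs K 0 ^ 2) ^ b 0 * (zs K 1 ^ 2) ^ b 1 * (zs K 2 ^ 2) ^ b 2)) =
      powerBracket K (a 0) (b 0) * powerBracket K (a 1) (b 1) * powerBracket K (a 2) (b 2)
      - powerBracket K (a 0 + a 1) (b 0 + b 1) * powerBracket K (a 2) (b 2)
      - powerBracket K (a 0 + a 2) (b 0 + b 2) * powerBracket K (a 1) (b 1)
      - powerBracket K (a 1 + a 2) (b 1 + b 2) * powerBracket K (a 0) (b 0)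
      + 2 * powerBracket K (a 0 + a 1 + a 2) (b 0 + b 1 + b 2) := by
    simp only [permSum, powerBracket, map_mul, map_pow, i1, i2, i3, i4, i5, i6, j1, j2, j3, j4,
      j5, j6, pow_add]
    generalize zs K 0 ^ 2 = z₀, zs K 1 ^ 2 = z₁, zs K 2 ^ 2 = z₂
    generalize xs K 0 = x₀, xs K 1 = x₁, xs K 2 = x₂
    -- After `pow_add` each power of a variable can be treated as an indeterminate, so symbolic
    -- exponents disappear from the identity.
    have gen (p₀ p₁ p₂ q₀ q₁ q₂ r₀ r₁ r₂ p₀' p₁' p₂' q₀' q₁' q₂' r₀' r₁' r₂' : R K) :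
        p₀ * q₁ * r₂ * (p₀' * q₁' * r₂') + p₁ * q₀ * r₂ * (p₁' * q₀' * r₂')
        + p₀ * q₂ * r₁ * (p₀' * q₂' * r₁') + p₁ * q₂ * r₀ * (p₁' * q₂' * r₀')
        + p₂ * q₀ * r₁ * (p₂' * q₀' * r₁') + p₂ * q₁ * r₀ * (p₂' * q₁' * r₀') =
        (p₀ * p₀' + p₁ * p₁' + p₂ * p₂') * (q₀ * q₀' + q₁ * q₁' + q₂ * q₂') *
          (r₀ * r₀' + r₁ * r₁' + r₂ * r₂')
        - (p₀ * q₀ * (p₀' * q₀') + p₁ * q₁ * (p₁' * q₁') + p₂ * q₂ * (p₂' * q₂')) *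
          (r₀ * r₀' + r₁ * r₁' + r₂ * r₂')
        - (p₀ * r₀ * (p₀' * r₀') + p₁ * r₁ * (p₁' * r₁') + p₂ * r₂ * (p₂' * r₂')) *
          (q₀ * q₀' + q₁ * q₁' + q₂ * q₂')
        - (q₀ * r₀ * (q₀' * r₀') + q₁ * r₁ * (q₁' * r₁') + q₂ * r₂ * (q₂' * r₂')) *
          (p₀ * p₀' + p₁ * p₁' + p₂ * p₂')
        + 2 * (p₀ * q₀ * r₀ * (p₀' * q₀' * r₀') + p₁ * q₁ * r₁ * (p₁' * q₁' * r₁') +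
          p₂ * q₂ * r₂ * (p₂' * q₂' * r₂')) := by ring
    rw [← gen]
  rw [h]
  exact add_mem (sub_mem (sub_mem (sub_mem (mul_mem (mul_mem (hp _ _) (hp _ _)) (hp _ _))
    (mul_mem (hp _ _) (hp _ _))) (mul_mem (hp _ _) (hp _ _))) (mul_mem (hp _ _) (hp _ _)))
    (mul_mem (ofNat_mem _ 2) (hp _ _))

theorem permSum_S_mul (g : R K) : permSum K (phiVar K .S * g) = phiVar K .S * permSum K g := by
  have h12 : act K (Equiv.swap 1 2) (phiVar K .S) = phiVar K .S := act_swap_phiVar K 1 .S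
  have h23 : act K (Equiv.swap 2 3) (phiVar K .S) = phiVar K .S := act_swap_phiVar K 2 .S
  simp only [permSum, map_mul, h12, h23]
  ring

theorem permSum_four_mul (g : R K) : permSum K (4 * g) = 4 * permSum K g := by
  simp only [permSum, map_mul, map_ofNat]
  ring

/-- The sign factor is 4 when the three z-exponents have equal parity and 0 otherwise. If all are
odd, the invariant factor z₁z₂z₃ splits off and even exponents remain. -/
theorem permSum_signSum_xzMonomial_mem (h2 : (2 : K) ≠ 0) (h3 : (3 : K) ≠ 0) (a b : Fin 3 → ℕ) :
    permSum K (signSum K (xzMonomial K a b)) ∈ (phi₁ K).range := by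
  rw [signSum_xzMonomial]
  have hS : phiVar K .S ∈ (phi₁ K).range := ⟨_, phi₁_X K ⟨.S, by decide⟩⟩
  have hzero : permSum K 0 ∈ (phi₁ K).range := by
    simp only [permSum, map_zero, add_zero]
    exact zero_mem _
  obtain ⟨c₀, h0⟩ := Nat.even_or_odd' (b 0)
  obtain ⟨c₁, h1⟩ := Nat.even_or_odd' (b 1)
  obtain ⟨c₂, h2'⟩ := Nat.even_or_odd' (b 2)
  have heven := permSum_even_mem K h2 h3 a ![c₀, c₁, c₂]
  simp only [Matrix.cons_val] at heven
  have hsum {s : R K} (e : (1 + (-1) ^ (b 1 + b 2) + (-1) ^ (b 0 + b 2) + (-1) ^ (b 0 + b 1)) *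
      xzMonomial K a b = s) (hs : permSum K s ∈ (phi₁ K).range) :
      permSum K ((1 + (-1) ^ (b 1 + b 2) + (-1) ^ (b 0 + b 2) + (-1) ^ (b 0 + b 1)) *
        xzMonomial K a b) ∈ (phi₁ K).range := e ▸ hs
  rcases h0 with h0 | h0 <;> rcases h1 with h1 | h1 <;> rcases h2' with h2' | h2'
  · refine hsum (s := 4 * _) ?_ (by
      rw [permSum_four_mul]
      exact mul_mem (ofNat_mem _ 4) heven)
    simp only [xzMonomial, h0, h1, h2', pow_add, pow_mul, neg_one_sq, one_pow]
    ring
  iterate 6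
    refine hsum (s := 0) ?_ hzero
    simp only [h0, h1, h2', pow_add, pow_mul, neg_one_sq, one_pow, pow_one]
    ring
  · refine hsum (s := 4 * (phiVar K .S * _)) ?_ (by
      rw [permSum_four_mul, permSum_S_mul]
      exact mul_mem (ofNat_mem _ 4) (mul_mem hS heven))
    simp only [xzMonomial, h0, h1, h2', pow_add, pow_mul, neg_one_sq, one_pow, pow_one, phiVar_S]
    ring

theorem permSum_signSum_mem (h2 : (2 : K) ≠ 0) (h3 : (3 : K) ≠ 0) (g : R K) :
    permSum K (signSum K g) ∈ (phi₁ K).range := by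
  have hadd (p q : R K) : permSum K (signSum K (p + q)) =
      permSum K (signSum K p) + permSum K (signSum K q) := by
    simp only [permSum, signSum, map_add]
    abel
  have hsmul (c : K) (p : R K) : permSum K (signSum K (c • p)) = c • permSum K (signSum K p) := by
    simp only [permSum, signSum, map_add, map_smul, smul_add]
  have hpoly (f : MvPolynomial (Fin 3 ⊕ Fin 3) K) :
      permSum K (signSum K (aeval (Sum.elim (xs K) (zs K)) f)) ∈ (phi₁ K).range := by
    induction f using MvPolynomial.induction_on' with
    | monomial u c =>
      have := permSum_signSum_xzMonomial_mem K h2 h3 (fun i => u (.inl i)) (fun i => u (.inr i))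
      have h : aeval (Sum.elim (xs K) (zs K)) (monomial u c) =
          c • xzMonomial K (fun i => u (.inl i)) (fun i => u (.inr i)) := by
        rw [aeval_monomial, Algebra.smul_def, Finsupp.prod_fintype _ _ (fun _ => pow_zero _),
          Fintype.prod_sum_type, Fin.prod_univ_three, Fin.prod_univ_three]
        rfl
      rw [h, hsmul]
      exact Subalgebra.smul_mem _ this c
    | add p q hp hq => rw [map_add, hadd]; exact add_mem hp hq
  -- Since 2 is invertible, the x_i and z_i generate R, so every element is covered by `hpoly`.
  have hid : (aeval (Sum.elim (xs K) (zs K))).comp (evalXZ K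
      (fun i => (X (.inl i) : MvPolynomial (Fin 3 ⊕ Fin 3) K)) (fun i => X (.inr i))) =
      AlgHom.id K (R K) := by
    set Θ := (aeval (Sum.elim (xs K) (zs K))).comp (evalXZ K
      (fun i => (X (.inl i) : MvPolynomial (Fin 3 ⊕ Fin 3) K)) (fun i => X (.inr i))) with hΘ
    have hx (i : Fin 3) : Θ (xs K i) = xs K i := by
      rw [hΘ, AlgHom.comp_apply, evalXZ_xs K h2, aeval_X]
      rfl
    have hz (i : Fin 3) : Θ (zs K i) = zs K i := by
      rw [hΘ, AlgHom.comp_apply, evalXZ_zs K h2, aeval_X]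
      rfl
    have h2' : (2 : R K) ≠ 0 := by
      rw [show (2 : R K) = C 2 from (map_ofNat C 2).symm]
      exact (map_ne_zero_iff _ (C_injective _ _)).2 h2
    have key {p q : R K} (ha : Θ (p + q) = p + q) (hs : Θ (p - q) = p - q) :
        Θ p = p ∧ Θ q = q := by
      rw [map_add] at ha
      rw [map_sub] at hs
      constructor <;> apply mul_left_cancel₀ h2'
      · linear_combination ha + hs
      · linear_combination ha - hs
    obtain ⟨k1, k2⟩ := key (hx 0) (hz 0)
    obtain ⟨k3, k4⟩ := key (hx 1) (hz 1)
    obtain ⟨k5, k6⟩ := key (hx 2) (hz 2)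
    apply MvPolynomial.algHom_ext
    intro p
    have hp : p = pair 0 1 (by decide) ∨ p = pair 2 3 (by decide) ∨ p = pair 0 2 (by decide) ∨
        p = pair 1 3 (by decide) ∨ p = pair 0 3 (by decide) ∨ p = pair 1 2 (by decide) := by
      revert p
      decide
    rcases hp with rfl | rfl | rfl | rfl | rfl | rfl
    exacts [k1, k2, k3, k4, k5, k6]
  rw [← AlgHom.id_apply (R := K) g, ← hid]
  exact hpoly _

theorem range_phi₁ (h2 : (2 : K) ≠ 0) (h3 : (3 : K) ≠ 0) : (phi₁ K).range = invariants K := by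
  refine le_antisymm (range_le_invariants K) fun f hf => ?_
  have h := permSum_signSum_mem K h2 h3 f
  have hact (σ : Equiv.Perm (Fin 4)) : act K σ f = f := hf σ
  -- The four sign changes and six permutations give 24 terms, each equal to the invariant f.
  have h24 : permSum K (signSum K f) = (24 : K) • f := by
    simp only [permSum, signSum, map_add, hact, Algebra.smul_def, map_ofNat]
    ring
  have h24' : (24 : K) ≠ 0 := by
    rw [show (24 : K) = 2 ^ 3 * 3 by norm_num]
    exact mul_ne_zero (pow_ne_zero 3 h2) h3
  rw [h24] at h
  have := Subalgebra.smul_mem _ h (24 : K)⁻¹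
  rwa [smul_smul, inv_mul_cancel₀ h24', one_smul] at this

/-! ### Minimality through derivatives at the origin. -/

/-- This dimension count bounds generating sets from below for both the algebra and the ideal.
Irredundancy then follows, as a proper subfamily would be a generating set that is too small. -/
theorem le_encard_of_span_eq_top {α : Type*} {t : Set α} {n : ℕ} (g : t → Fin n → K)
    (h : Submodule.span K (Set.range g) = ⊤) : ENat.card (Fin n) ≤ t.encard := by
  rcases t.finite_or_infinite with ht | ht
  · have : Fintype t := ht.fintype
    have h1 := finrank_range_le_card (R := K) g
    rw [Set.finrank, h, finrank_top, Module.finrank_fin_fun] at h1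
    rw [ENat.card_eq_coe_fintype_card, Fintype.card_fin, ← Set.coe_fintypeCard]
    exact_mod_cast h1
  · rw [ht.encard_eq]
    exact le_top

theorem encard_image_lt {n : ℕ} {α : Type*} (g : Fin n → α) {s : Set (Fin n)}
    (hs : s ≠ Set.univ) : (g '' s).encard < ENat.card (Fin n) := by
  refine (Set.encard_image_le g s).trans_lt ?_
  rw [← Set.encard_univ]
  exact (Set.toFinite s).encard_lt_encard (Set.ssubset_univ_iff.2 hs)

/-- The value at the origin. -/
def atZero : F₁ K →ₐ[K] K := aeval 0

/-- The partial derivative at the origin. -/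
def deriv₁ (v : {v : Label // v ≠ .y3}) : F₁ K →ₗ[K] K :=
  (atZero K).toLinearMap ∘ₗ (pderiv v).toLinearMap

/-- The second partial derivative at the origin. -/
def deriv₂ (v w : {v : Label // v ≠ .y3}) : F₁ K →ₗ[K] K :=
  (atZero K).toLinearMap ∘ₗ (pderiv v).toLinearMap ∘ₗ (pderiv w).toLinearMap

theorem deriv₁_apply (v : {v : Label // v ≠ .y3}) (f : F₁ K) :
    deriv₁ K v f = atZero K (pderiv v f) := rfl

theorem deriv₂_apply (v w : {v : Label // v ≠ .y3}) (f : F₁ K) :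
    deriv₂ K v w f = atZero K (pderiv v (pderiv w f)) := rfl

theorem deriv₁_mul (v : {v : Label // v ≠ .y3}) (f g : F₁ K) :
    deriv₁ K v (f * g) = atZero K f * deriv₁ K v g + atZero K g * deriv₁ K v f := by
  simp only [deriv₁_apply, Derivation.leibniz, smul_eq_mul, map_add, map_mul]

theorem deriv₂_mul (v w : {v : Label // v ≠ .y3}) (f g : F₁ K) :
    deriv₂ K v w (f * g) = atZero K f * deriv₂ K v w g + deriv₁ K v f * deriv₁ K w g +
      deriv₁ K w f * deriv₁ K v g + atZero K g * deriv₂ K v w f := by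
  simp only [deriv₁_apply, deriv₂_apply, Derivation.leibniz, smul_eq_mul, map_add, map_mul]
  ring

theorem deriv₁_C (v : {v : Label // v ≠ .y3}) (c : K) : deriv₁ K v (C c) = 0 := by
  rw [deriv₁_apply, pderiv_C, map_zero]

theorem deriv₁_ofNat (v : {v : Label // v ≠ .y3}) (n : ℕ) [n.AtLeastTwo] :
    deriv₁ K v (ofNat(n) : F₁ K) = 0 := by
  rw [← map_ofNat C n, deriv₁_C]

theorem atZero_T₁ (v : Label) (h : v ≠ .y3) : atZero K (T₁ K v h) = 0 := aeval_X _ _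

theorem deriv₁_T₁ (v : {v : Label // v ≠ .y3}) (w : Label) (h : w ≠ .y3) :
    deriv₁ K v (T₁ K w h) = if w = v then 1 else 0 := by
  rw [deriv₁_apply, T₁, pderiv_X]
  by_cases hvw : w = v
  · obtain ⟨v, hv⟩ := v
    obtain rfl : w = v := hvw
    simp
  · rw [if_neg hvw, Pi.single_eq_of_ne (fun h => hvw (congrArg Subtype.val h)), map_zero]

theorem deriv₂_T₁ (v v' : {v : Label // v ≠ .y3}) (w : Label) (h : w ≠ .y3) :
    deriv₂ K v v' (T₁ K w h) = 0 := by
  rw [deriv₂_apply, T₁, pderiv_X, Pi.single_apply]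
  split_ifs <;> simp

theorem atZero_y3Value : atZero K (y3Value K) = 0 := by
  simp only [y3Value, map_add, map_sub, map_mul, map_pow, atZero_T₁]
  ring

theorem deriv₁_y3Value (v : {v : Label // v ≠ .y3}) : deriv₁ K v (y3Value K) = 0 := by
  simp only [y3Value, map_add, map_sub, pow_succ, pow_zero, one_mul, map_mul, deriv₁_mul,
    atZero_T₁, deriv₁_C, deriv₁_ofNat, zero_mul, mul_zero, add_zero, sub_zero]

theorem Jtilde_eq (i : Fin 5) : Jtilde K i = subst K (![J32 K, J23 K, J42 K, J33 K, J24 K] i) := by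
  fin_cases i <;> rfl

theorem atZero_deriv₁_Jtilde (i : Fin 5) :
    atZero K (Jtilde K i) = 0 ∧ ∀ v, deriv₁ K v (Jtilde K i) = 0 := by
  have sx := subst_T₁ K .x (by decide)
  have sx2 := subst_T₁ K .x2 (by decide)
  have sx3 := subst_T₁ K .x3 (by decide)
  have sy := subst_T₁ K .y (by decide)
  have sy2 := subst_T₁ K .y2 (by decide)
  have sxy := subst_T₁ K .xy (by decide)
  have sx2y := subst_T₁ K .x2y (by decide)
  have sxy2 := subst_T₁ K .xy2 (by decide)
  rw [Jtilde_eq]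
  constructor
  · fin_cases i <;> simp [J32, J23, J42, J33, J24, subst_T_y3, sx, sx2, sx3, sy, sy2, sxy, sx2y,
      sxy2, atZero_T₁, atZero_y3Value]
  · intro v
    fin_cases i <;> simp [J32, J23, J42, J33, J24, subst_T_y3, sx, sx2, sx3, sy, sy2, sxy, sx2y,
      sxy2, atZero_T₁, atZero_y3Value, deriv₁_mul, pow_succ]

/-- The relations start in degree two, and the vanishing of value and gradient passes to the ideal
by the Leibniz rule. The linear part of a lift is therefore determined by its image in R. -/
theorem atZero_deriv₁_ker {f : F₁ K} (hf : f ∈ Ideal.span (Set.range (Jtilde K))) :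
    atZero K f = 0 ∧ ∀ v, deriv₁ K v f = 0 := by
  induction hf using Submodule.span_induction with
  | mem f hf =>
    obtain ⟨i, rfl⟩ := hf
    exact atZero_deriv₁_Jtilde K i
  | zero => exact ⟨map_zero _, fun v => map_zero _⟩
  | add f g _ _ hf hg =>
    refine ⟨by rw [map_add, hf.1, hg.1, add_zero], fun v => by rw [map_add, hf.2, hg.2, add_zero]⟩
  | smul a f _ hf =>
    refine ⟨by rw [smul_eq_mul, map_mul, hf.1, mul_zero], fun v => ?_⟩
    rw [smul_eq_mul, deriv₁_mul, hf.1, hf.2, mul_zero, zero_mul, add_zero]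

/-- The second derivatives at the origin with respect to five pairs of variables. -/
def hessian : F₁ K →ₗ[K] Fin 5 → K :=
  LinearMap.pi ![deriv₂ K ⟨.xy, by decide⟩ ⟨.x2y, by decide⟩,
    deriv₂ K ⟨.xy, by decide⟩ ⟨.xy2, by decide⟩, deriv₂ K ⟨.x2y, by decide⟩ ⟨.x2y, by decide⟩,
    deriv₂ K ⟨.x2y, by decide⟩ ⟨.xy2, by decide⟩, deriv₂ K ⟨.xy2, by decide⟩ ⟨.xy2, by decide⟩]

-- Among uv, uw, v², vw, w², each J̃ contains exactly one as a quadratic term. The polynomial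
-- replacing T_{y³} has no constant or linear term, so it contributes nothing; squares double the
-- coefficient.
set_option maxHeartbeats 2000000 in
theorem hessian_Jtilde (i : Fin 5) :
    hessian K (Jtilde K i) = (![6, 6, 12, 3, 12] i : K) • Pi.single i 1 := by
  have sx := subst_T₁ K .x (by decide)
  have sx2 := subst_T₁ K .x2 (by decide)
  have sx3 := subst_T₁ K .x3 (by decide)
  have sy := subst_T₁ K .y (by decide)
  have sy2 := subst_T₁ K .y2 (by decide)
  have sxy := subst_T₁ K .xy (by decide)
  have sx2y := subst_T₁ K .x2y (by decide)
  have sxy2 := subst_T₁ K .xy2 (by decide)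
  have s3 : atZero K (subst K 3) = 3 := (congrArg _ (map_ofNat (subst K) 3)).trans (map_ofNat _ 3)
  have s6 : atZero K (subst K 6) = 6 := (congrArg _ (map_ofNat (subst K) 6)).trans (map_ofNat _ 6)
  rw [Jtilde_eq]
  ext j
  fin_cases i <;> fin_cases j <;> simp [hessian, J32, J23, J42, J33, J24, subst_T_y3, sx, sx2,
    sx3, sy, sy2, sxy, sx2y, sxy2, atZero_T₁, atZero_y3Value, deriv₁_mul, deriv₂_mul,
    deriv₁_T₁, deriv₂_T₁, deriv₁_y3Value, pow_succ, s3, s6]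
  all_goals norm_num

/-- On the ideal only one term of the Leibniz expansion survives, so `hessian` factors through the
ideal modulo its product with the maximal ideal at the origin. -/
theorem hessian_mul {f : F₁ K} (hf : f ∈ Ideal.span (Set.range (Jtilde K))) (a : F₁ K) :
    hessian K (a * f) = atZero K a • hessian K f := by
  obtain ⟨h0, h1⟩ := atZero_deriv₁_ker K hf
  have key (v w) : deriv₂ K v w (a * f) = atZero K a * deriv₂ K v w f := by
    rw [deriv₂_mul, h0, h1, h1]
    ring
  ext j
  fin_cases j <;> exact key _ _

theorem Jtilde_minimal (h2 : (2 : K) ≠ 0) (h3 : (3 : K) ≠ 0) :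
    MinimallyGeneratesIdeal (Jtilde K) (RingHom.ker (phi₁ K)) := by
  have hcard : ∀ t : Set (F₁ K), Ideal.span t = RingHom.ker (phi₁ K) →
      ENat.card (Fin 5) ≤ t.encard := by
    intro t ht
    rw [← ker_phi₁ K h2 h3] at ht
    refine le_encard_of_span_eq_top K (fun f : t => hessian K f) ?_
    set U := Submodule.span K (Set.range fun f : t => hessian K f)
    have hU {f : F₁ K} (hf : f ∈ Ideal.span t) : hessian K f ∈ U := by
      induction hf using Submodule.span_induction with
      | mem f hf => exact Submodule.subset_span ⟨⟨f, hf⟩, rfl⟩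
      | zero => rw [map_zero]; exact zero_mem _
      | add f g _ _ hf hg => rw [map_add]; exact add_mem hf hg
      | smul a f hf hf' =>
        have hf : f ∈ Ideal.span t := hf
        rw [ht] at hf
        rw [smul_eq_mul, hessian_mul K hf]
        exact U.smul_mem _ hf'
    -- The J̃ lie in the ideal spanned by `t` and their images are nonzero multiples of the basis
    -- vectors, so the images of `t` span.
    rw [eq_top_iff, ← (Pi.basisFun K (Fin 5)).span_eq, Submodule.span_le]
    rintro _ ⟨i, rfl⟩
    have hi : hessian K (Jtilde K i) ∈ U := hU (ht ▸ Ideal.subset_span ⟨i, rfl⟩)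
    rw [hessian_Jtilde] at hi
    rw [Pi.basisFun_apply]
    refine (U.smul_mem_iff ?_).1 hi
    have h6 : (6 : K) ≠ 0 := by
      rw [show (6 : K) = 2 * 3 by norm_num]
      exact mul_ne_zero h2 h3
    have h12 : (12 : K) ≠ 0 := by
      rw [show (12 : K) = 2 * 6 by norm_num]
      exact mul_ne_zero h2 h6
    fin_cases i
    exacts [h6, h6, h12, h3, h12]
  exact ⟨ker_phi₁ K h2 h3,
    fun s hs h => (hcard _ h).not_gt (encard_image_lt _ hs), hcard⟩

/-- The labels of the nine generators. -/
def nineLabels : Fin 9 → {v : Label // v ≠ .y3} :=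
  ![⟨.x, by decide⟩, ⟨.x2, by decide⟩, ⟨.x3, by decide⟩, ⟨.y, by decide⟩, ⟨.y2, by decide⟩,
    ⟨.xy, by decide⟩, ⟨.x2y, by decide⟩, ⟨.xy2, by decide⟩, ⟨.S, by decide⟩]

theorem nineLabels_injective : Function.Injective nineLabels := by
  decide

theorem nineLabels_surjective : Function.Surjective nineLabels := by
  rintro ⟨v, hv⟩
  cases v
  exacts [⟨0, rfl⟩, ⟨1, rfl⟩, ⟨2, rfl⟩, ⟨3, rfl⟩, ⟨4, rfl⟩, absurd rfl hv, ⟨5, rfl⟩, ⟨6, rfl⟩,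
    ⟨7, rfl⟩, ⟨8, rfl⟩]

theorem nineGenerators_eq : nineGenerators K = fun i => phi₁ K (X (nineLabels i)) := by
  have p0 : psi K (X 0) = X 0 := aeval_X _ _
  have p1 : psi K (X 1) = X 1 ^ 2 := aeval_X _ _
  have h4 : ((X 1 : MvPolynomial (Fin 2) K) ^ 2) ^ 2 = X 1 ^ 4 := by ring
  funext i
  rw [phi₁_X]
  fin_cases i <;> simp [nineGenerators, nineLabels, phiVar, p0, p1, h4]

theorem adjoin_nineGenerators :
    Algebra.adjoin K (Set.range (nineGenerators K)) = (phi₁ K).range := by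
  rw [nineGenerators_eq, show (fun i => phi₁ K (X (nineLabels i))) =
    (phi₁ K ∘ X) ∘ nineLabels from rfl, nineLabels_surjective.range_comp, Set.range_comp,
    ← AlgHom.map_adjoin, adjoin_range_X, Algebra.map_top]

theorem nineGenerators_minimal (h2 : (2 : K) ≠ 0) (h3 : (3 : K) ≠ 0) :
    MinimallyGeneratesAlgebra K (nineGenerators K) (invariants K) := by
  have hcard : ∀ t : Set (R K), Algebra.adjoin K t = invariants K →
      ENat.card (Fin 9) ≤ t.encard := by
    intro t ht
    rw [← range_phi₁ K h2 h3] at ht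
    -- Generators are lifted to F₁, where linear parts make sense. By the Leibniz rule the linear
    -- part of any polynomial in the lifts lies in the span of theirs.
    have hlift (y : t) : ∃ f, phi₁ K f = y :=
      (AlgHom.mem_range _).1 (ht ▸ Algebra.subset_adjoin y.2)
    choose g hg using hlift
    let L : F₁ K →ₗ[K] Fin 9 → K := LinearMap.pi fun i => deriv₁ K (nineLabels i)
    refine le_encard_of_span_eq_top K (fun y : t => L (g y)) ?_
    set U := Submodule.span K (Set.range fun y : t => L (g y))
    have hU {f : F₁ K} (hf : f ∈ Algebra.adjoin K (Set.range g)) : L f ∈ U := by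
      induction hf using Algebra.adjoin_induction with
      | mem f hf =>
        obtain ⟨y, rfl⟩ := hf
        exact Submodule.subset_span ⟨y, rfl⟩
      | algebraMap c =>
        have : L (algebraMap K (F₁ K) c) = 0 := funext fun i => deriv₁_C K _ c
        rw [this]
        exact zero_mem _
      | add f g _ _ hf hg => rw [map_add]; exact add_mem hf hg
      | mul f g _ _ hf hg =>
        have : L (f * g) = atZero K f • L g + atZero K g • L f :=
          funext fun i => deriv₁_mul K _ f g
        rw [this]
        exact add_mem (U.smul_mem _ hg) (U.smul_mem _ hf)
    have hmap : (Algebra.adjoin K (Set.range g)).map (phi₁ K) = (phi₁ K).range := by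
      rw [AlgHom.map_adjoin, ← Set.range_comp, ← ht]
      congr 1
      ext y
      constructor
      · rintro ⟨y, rfl⟩
        rw [Function.comp_apply, hg]
        exact y.2
      · exact fun hy => ⟨⟨y, hy⟩, hg ⟨y, hy⟩⟩
    rw [eq_top_iff, ← (Pi.basisFun K (Fin 9)).span_eq, Submodule.span_le]
    rintro _ ⟨i, rfl⟩
    have hX : phi₁ K (X (nineLabels i)) ∈ (Algebra.adjoin K (Set.range g)).map (phi₁ K) :=
      hmap ▸ ⟨_, rfl⟩
    obtain ⟨f, hf, hfX⟩ := hX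
    -- The variable and the polynomial in the lifts with the same image differ by an element of the
    -- kernel, hence have the same linear part.
    have hker : f - X (nineLabels i) ∈ Ideal.span (Set.range (Jtilde K)) := by
      rw [ker_phi₁ K h2 h3, RingHom.mem_ker, map_sub, sub_eq_zero]
      exact hfX
    have hL : L (f - X (nineLabels i)) = 0 := funext fun j => (atZero_deriv₁_ker K hker).2 _
    have hLX : L (X (nineLabels i)) = Pi.basisFun K (Fin 9) i := by
      funext j
      change deriv₁ K (nineLabels j) (T₁ K (nineLabels i).1 (nineLabels i).2) = _
      rw [deriv₁_T₁, Pi.basisFun_apply, Pi.single_apply]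
      refine if_congr ?_ rfl rfl
      rw [Subtype.coe_inj, nineLabels_injective.eq_iff, eq_comm]
    rw [map_sub, sub_eq_zero] at hL
    rw [← hLX, ← hL]
    exact hU hf
  exact ⟨(adjoin_nineGenerators K).trans (range_phi₁ K h2 h3),
    fun s hs h => (hcard _ h).not_gt (encard_image_lt _ hs), hcard⟩

end PairInvariants

end

theorem corollary5p3 (K : Type*) [Field K] (p : ℕ) [CharP K p] (hp : p = 0 ∨ 3 < p) :
    PairInvariants.MinimallyGeneratesAlgebra K (PairInvariants.nineGenerators K)
      (PairInvariants.invariants K) ∧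
    (PairInvariants.phi₁ K).range = PairInvariants.invariants K ∧
    PairInvariants.MinimallyGeneratesIdeal (PairInvariants.Jtilde K)
      (RingHom.ker (PairInvariants.phi₁ K)) := by
  -- The characteristic enters only through the invertibility of 2 and 3.
  have hn (n : ℕ) (hn : 0 < n) (hn3 : n ≤ 3) : (n : K) ≠ 0 := by
    rw [Ne, CharP.cast_eq_zero_iff K p]
    intro h
    rcases hp with rfl | hp
    · exact hn.ne' (zero_dvd_iff.1 h)
    · exact absurd (Nat.le_of_dvd hn h) (by omega)
  have h2 : (2 : K) ≠ 0 := by exact_mod_cast hn 2 (by decide) (by decide)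
  have h3 : (3 : K) ≠ 0 := by exact_mod_cast hn 3 (by decide) (by decide)
  exact ⟨PairInvariants.nineGenerators_minimal K h2 h3, PairInvariants.range_phi₁ K h2 h3,
    PairInvariants.Jtilde_minimal K h2 h3⟩
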